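/- Notation. $|\cdot|$ is the Euclidean norm on $\mathbb{R}^d$, $d\ge 1$; $\underline\lambda_A$ and $\bar\lambda_A$ are the lowest and highest eigenvalues of a symmetric matrix $A$; $[f]_1$ is the (smallest) Lipschitz constant of $f$; $a\vee b=\max(a,b)$. Let $\sigma>0$, $r\in[0,1)$. Assume $(\mathbf{H}_r^1)$: $U:\mathbb{R}^d\to\mathbb{R}$ is a positive, convex $\mathcal{C}^2$-function with a unique minimum $x^\star$, $U(x^\star)=1$; $\nabla U$ is $L$-Lipschitz with $L\ge 1$; and for some $\underline c>0$ one has, for all $x\in\mathbb{R}^d$, $\underline\lambda_{D^2U(x)}\ge \underline c\,U(x)^{-r}>0$. Consider also $(\mathbf{H}_r^2)$: for some $\bar c>0$, $\bar\lambda_{D^2U(x)}\le \bar c\,U(x)^{-r}$ for all $x\in\mathbb{R}^d$. Define $$(\gamma^\star,\bar\Psi)=\begin{cases}\left(\frac{1}{4L},\,(1+\sigma^2)\Big(dL+\big(1+\tfrac{dL}{\underline c}\big)^{\frac1{1-r}}\Big)\right)&\text{if only }(\mathbf{H}_r^1)\text{ is assumed},\\[4pt] \left(\frac{1-r}{4(\bar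 c\vee L)},\,c_r\,\frac{d(1+\sigma^2)(\bar c\vee L)}{\underline c}\right)&\text{if }(\mathbf{H}_r^1)\text{ and }(\mathbf{H}_r^2)\text{ are assumed},\end{cases}$$ where $c_r>0$ is a constant depending only on $r$. For $\gamma\in(0,\gamma^\star]$ and $x\in\mathbb{R}^d$, let $\bar X_0=x$ and $$\bar X_{(n+1)\gamma}=\bar X_{n\gamma}-\gamma\nabla U(\bar X_{n\gamma})+\sigma\sqrt{\gamma}\,Z_{n+1},\qquad n\ge 0,$$ with $(Z_n)$ i.i.d. standard Gaussian vectors of $\mathbb{R}^d$; write $\mathbb{E}_x$ for the expectation. Proposition. In either case, for every $\gamma\in(0,\gamma^\star]$ the chain $(\bar X_{n\gamma})_{n\ge0}$ has a unique invariant probability measure $\pi^\gamma$. Let moreover $\kappa>0$, let $\phi:\mathbb{R}_+\to\mathbb{R}$ be a positive function, and let $x\in\mathbb{R}^d$ satisfy $U(x)\le C_r\bar\Psi$, where $C_r>0$ depends only on $r$. Then there is a constant $c_{r,\kappa}$, depending only on $r$ and $\kappa$ (through $r,\kappa,c_r,C_r$; in particular not on $d,\sigma,L,\underline c,\bar c,U,\gamma,x,\phi$),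 such that for all integers $n>0$ and all Lipschitz continuous $f:\mathbb{R}^d\to\mathbb{R}$, both $f(\bar X_{n\gamma})$ and $f$ (under $\pi^\gamma$) are integrable and $$\left|\mathbb{E}_x[f(\bar X_{n\gamma})]-\pi^\gamma(f)\right|\le c_{r,\kappa}\,[f]_1\,h_{\phi,\kappa}(n),$$ where $$h_{\phi,\kappa}(n)=\underline c^{-\frac12}\,\bar\Psi^{\frac{1+r}{2}}e^{-\phi(n)}+\underline c^{-\frac{\kappa+1}{2}}\,\bar\Psi^{\frac{1+r(1+\kappa)}{2}}\left(\frac{\phi(n)}{n\gamma}\right)^{\frac{\kappa}{2}}.$$ -/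

import Mathlib

open MeasureTheory ProbabilityTheory
open scoped Gradient NNReal

noncomputable section

/-- The state space `ℝ^d` with its Euclidean norm. -/
abbrev Rd (d : ℕ) : Type := EuclideanSpace ℝ (Fin d)

/-- The Hessian `D²U(x)`, as the operator obtained by differentiating the gradient. -/
def hessian {d : ℕ} (U : Rd d → ℝ) (x : Rd d) : Rd d →L[ℝ] Rd d :=
  fderiv ℝ (∇ U) x

/-- The lowest eigenvalue of a (symmetric) operator. -/
def lowestEigenvalue {d : ℕ} (A : Rd d →L[ℝ] Rd d) : ℝ :=
  sInf {μ : ℝ | Module.End.HasEigenvalue (A : Rd d →ₗ[ℝ] Rd d) μ}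

/-- The highest eigenvalue of a (symmetric) operator. -/
def highestEigenvalue {d : ℕ} (A : Rd d →L[ℝ] Rd d) : ℝ :=
  sSup {μ : ℝ | Module.End.HasEigenvalue (A : Rd d →ₗ[ℝ] Rd d) μ}

/-- Assumption `(H_r^1)` with parameters `L` and `c` (the lower constant). -/
structure HypH1 {d : ℕ} (r L c : ℝ) (U : Rd d → ℝ) : Prop where
  pos : ∀ x, 0 < U x
  contDiff : ContDiff ℝ 2 U
  convex : ConvexOn ℝ Set.univ U
  exists_unique_min : ∃ xs : Rd d, U xs = 1 ∧ ∀ y, y ≠ xs → 1 < U y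
  one_le_L : 1 ≤ L
  lipschitz_gradient : ∀ x y, ‖∇ U x - ∇ U y‖ ≤ L * ‖x - y‖
  c_pos : 0 < c
  eigenvalue_pos : ∀ x, 0 < lowestEigenvalue (hessian U x)
  le_eigenvalue : ∀ x, c * (U x) ^ (-r) ≤ lowestEigenvalue (hessian U x)

/-- Assumption `(H_r^2)` with parameter `cbar` (the upper constant). -/
structure HypH2 {d : ℕ} (r cbar : ℝ) (U : Rd d → ℝ) : Prop where
  cbar_pos : 0 < cbar
  eigenvalue_le : ∀ x, highestEigenvalue (hessian U x) ≤ cbar * (U x) ^ (-r)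

/-- `(γ⋆, Ψ̄)` is the pair of parameters attached to `(H_r^1)` alone (first alternative), or to
`(H_r^1)` and `(H_r^2)` together (second alternative, where `cr` is a constant that only depends
on `r`). -/
def IsParameterPair {d : ℕ} (r cr σ L c : ℝ) (U : Rd d → ℝ) (γstar Ψ : ℝ) : Prop :=
  (γstar = 1 / (4 * L) ∧
    Ψ = (1 + σ ^ 2) * (d * L + (1 + d * L / c) ^ (1 / (1 - r)))) ∨
  (∃ cbar : ℝ, HypH2 r cbar U ∧
    γstar = (1 - r) / (4 * max cbar L) ∧
    Ψ = cr * (d * (1 + σ ^ 2) * max cbar L / c))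

/-- The Euler scheme `X̄_{nγ}` started at `x`, driven by the noise `Z_1, Z_2, …`. -/
def eulerScheme {d : ℕ} {Ω : Type*} (U : Rd d → ℝ) (σ γ : ℝ) (Z : ℕ → Ω → Rd d) (x : Rd d) :
    ℕ → Ω → Rd d
  | 0 => fun _ => x
  | n + 1 => fun ω =>
      eulerScheme U σ γ Z x n ω - γ • ∇ U (eulerScheme U σ γ Z x n ω)
        + (σ * √γ) • Z (n + 1) ω

/-- `(Z_n)` is an i.i.d. sequence of standard Gaussian vectors of `ℝ^d`. -/
structure IsGaussianNoise {d : ℕ} {Ω : Type*} [MeasurableSpace Ω] (P : Measure Ω)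
    (Z : ℕ → Ω → Rd d) : Prop where
  hasLaw : ∀ n, HasLaw (Z n) (stdGaussian (Rd d)) P
  indep : iIndepFun Z P

/-- `ν` is an invariant probability measure of the Euler scheme: if `X` has law `ν` and `Z` is an
independent standard Gaussian vector, then `X - γ ∇U(X) + σ √γ Z` has law `ν`. -/
structure IsEulerInvariant {d : ℕ} (U : Rd d → ℝ) (σ γ : ℝ) (ν : Measure (Rd d)) : Prop where
  isProbabilityMeasure : IsProbabilityMeasure ν
  map_eq : (ν.prod (stdGaussian (Rd d))).map
    (fun p : Rd d × Rd d => p.1 - γ • ∇ U p.1 + (σ * √γ) • p.2) = ν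

/-- The Lipschitz constant `[f]_1`, i.e. the smallest one. -/
def lipConst {d : ℕ} (f : Rd d → ℝ) : ℝ :=
  ((sInf {K : ℝ≥0 | LipschitzWith K f} : ℝ≥0) : ℝ)

/-- The rate `h_{φ,κ}(n)`. -/
def rate (r κ γ c Ψ : ℝ) (φ : ℝ≥0 → ℝ) (n : ℕ) : ℝ :=
  c ^ (-(1 / 2 : ℝ)) * Ψ ^ ((1 + r) / 2) * Real.exp (-φ n)
    + c ^ (-((κ + 1) / 2)) * Ψ ^ ((1 + r * (1 + κ)) / 2) * (φ n / (n * γ)) ^ (κ / 2)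

end

/-!
Two copies of the Euler scheme driven by the same noise approach each other, and the speed at which
they do so is read off from the time averages of `U` along the two paths. Write `xs` for the
minimizer, `V x = ‖x - xs‖ ^ 2`, `T = c n γ / Ψ ^ r`, and `v = c V / Ψ ^ (1 + r)`
(`scaledSqDist`). Besides `γ L ≤ 1`, the argument only uses that `Ψ` is at least a constant times
`d (1 + σ ^ 2)`; both choices of parameters satisfy these bounds (`IsParameterPair.bounds`), the
second one because `c ≤ L`.

*Contraction.* The gradient of `U` is cocoercive, and it is strongly monotone with constant
`c W ^ (-r)` between two points of the sublevel set `{U ≤ W}`. Hence a gradient step contracts by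
`exp (-γ c W ^ (-r) / 2)`. By Jensen's inequality the product of these factors along two paths is at
most `exp (-T / 2 * (ω / Ψ) ^ (-r))`, where `ω` is the time average of the sum of the two values of
`U`, and this is `O(T ^ (-m) (1 + ω / Ψ) ^ m)` for every `m` (`norm_chain_sub_le_excess`).

*Time averages of `U`.* A gradient step decreases `V` by at least `γ (U - 1)`. So the sum `S` of
`V` and of the time integral of `U - 1` is not raised by the drift, while its increments due to the
noise have a conditional variance at most proportional to `S` itself, as for a squared Bessel
process. This gives `E S ^ p ≤ C (V x + n γ σ ^ 2 d) ^ p` for all `p`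
(`exists_lintegral_sq_add_excess_le`), with constants that depend on `p` only. When `T ≥ 1`, the
resulting bound on `E (ω / Ψ) ^ p` is a polynomial in the values of `v` at the two starting points,
which yields `exists_lintegral_norm_chain_sub_le`. No moment of `U` itself is needed.

*The invariant law.* Since `v ≤ 4 (U / Ψ) ^ (1 + r)`, the powers of `v` are Lyapunov functions with
constants independent of the data (`exists_lintegral_scaledSqDist_succ_le`). The averages of the
laws of the chain started at `xs` therefore have uniformly bounded moments of `v`; they are tight,
and a limit given by Prokhorov's theorem is an invariant law that has the same moments
(`exists_isEulerInvariant`). Uniqueness follows from the contraction (`IsEulerInvariant.unique`).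

*The rate.* Whatever `φ`, one has `exp (-φ) + (φ / T) ^ (κ / 2) ≥ exp (-1) * min 1 (T ^ (-κ / 2))`.
It is thus enough to compare with this power of `T` when `T ≥ 1`, and with a constant when `T ≤ 1`,
where the coupled chains are simply not farther apart than their starting points. The second
starting point is finally integrated against the invariant law, whose moments of `v` are bounded.
-/

noncomputable section

/-! ### Convex functions with Lipschitz gradient -/

section Smooth

variable {E : Type*} [NormedAddCommGroup E] [InnerProductSpace ℝ E] [CompleteSpace E]
  {U : E → ℝ}

lemma hasDerivAt_comp_segment (hU : Differentiable ℝ U) (x h : E) (t : ℝ) :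
    HasDerivAt (fun s : ℝ => U (x + s • h)) (inner ℝ (∇ U (x + t • h)) h) t := by
  have h1 := (hU (x + t • h)).hasGradientAt.hasFDerivAt
  have h2 : HasDerivAt (fun s : ℝ => x + s • h) h t := by
    simpa using ((hasDerivAt_id t).smul_const h).const_add x
  exact h1.comp_hasDerivAt t h2

lemma ConvexOn.add_inner_gradient_le (hU : Differentiable ℝ U) (hc : ConvexOn ℝ Set.univ U)
    (x y : E) : U y + inner ℝ (∇ U y) (x - y) ≤ U x := by
  have hconv : ConvexOn ℝ Set.univ (fun t : ℝ => U (y + t • (x - y))) := by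
    have := hc.comp_affineMap (AffineMap.lineMap y x : ℝ →ᵃ[ℝ] E)
    refine (this.subset (Set.subset_univ _) convex_univ).congr ?_
    intro t _
    simp [AffineMap.lineMap_apply, add_comm]
  have hd := hasDerivAt_comp_segment hU y (x - y) 0
  have := hconv.le_slope_of_hasDerivAt (Set.mem_univ 0) (Set.mem_univ 1) one_pos hd
  simp only [slope_def_field, zero_smul, add_zero, one_smul, sub_zero, div_one,
    add_sub_cancel] at this
  linarith

/-- The descent lemma: a function whose gradient is `L`-Lipschitz lies below the paraboloid of
curvature `L` tangent to its graph at any point. -/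
lemma le_add_inner_gradient_add_sq {L : ℝ} (hU : Differentiable ℝ U)
    (hL : ∀ x y, ‖∇ U x - ∇ U y‖ ≤ L * ‖x - y‖) (x h : E) :
    U (x + h) ≤ U x + inner ℝ (∇ U x) h + L / 2 * ‖h‖ ^ 2 := by
  let q : ℝ → ℝ := fun t => U (x + t • h) - t * inner ℝ (∇ U x) h - L / 2 * ‖h‖ ^ 2 * t ^ 2
  have hq : ∀ t, HasDerivAt q
      (inner ℝ (∇ U (x + t • h)) h - inner ℝ (∇ U x) h - L * ‖h‖ ^ 2 * t) t := by
    intro t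
    have h1 := ((hasDerivAt_comp_segment hU x h t).sub
      ((hasDerivAt_id t).mul_const (inner ℝ (∇ U x) h))).sub
      ((hasDerivAt_pow 2 t).const_mul (L / 2 * ‖h‖ ^ 2))
    refine h1.congr_deriv ?_
    simp only [Nat.cast_ofNat, Nat.add_one_sub_one, pow_one]
    ring
  have hanti : AntitoneOn q (Set.Icc 0 1) := by
    refine antitoneOn_of_deriv_nonpos (convex_Icc 0 1)
      (fun t _ => (hq t).continuousAt.continuousWithinAt)
      (fun t _ => (hq t).differentiableAt.differentiableWithinAt) ?_
    intro t ht
    rw [interior_Icc] at ht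
    rw [(hq t).deriv, ← inner_sub_left]
    have h1 := real_inner_le_norm (∇ U (x + t • h) - ∇ U x) h
    have h2 := hL (x + t • h) x
    rw [add_sub_cancel_left, norm_smul, Real.norm_of_nonneg ht.1.le] at h2
    nlinarith [mul_le_mul_of_nonneg_right h2 (norm_nonneg h)]
  have := hanti (Set.left_mem_Icc.2 zero_le_one) (Set.right_mem_Icc.2 zero_le_one) zero_le_one
  simp only [q, one_smul, zero_smul, add_zero] at this
  linarith

/-- Cocoercivity of the gradient of a convex function with Lipschitz gradient
(Baillon-Haddad). -/
lemma norm_sq_gradient_sub_le {L : ℝ} (hL0 : 0 < L) (hU : Differentiable ℝ U)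
    (hc : ConvexOn ℝ Set.univ U) (hL : ∀ x y, ‖∇ U x - ∇ U y‖ ≤ L * ‖x - y‖) (x y : E) :
    ‖∇ U x - ∇ U y‖ ^ 2 ≤ L * inner ℝ (∇ U x - ∇ U y) (x - y) := by
  -- Compare the tangent plane at `b` with the value of `U` after a gradient step from `a` for
  -- `U - ⟪∇ U b, ·⟫`.
  have key : ∀ a b : E, ‖∇ U a - ∇ U b‖ ^ 2 / (2 * L) ≤
      U a - U b - inner ℝ (∇ U b) (a - b) := by
    intro a b
    set g := ∇ U a - ∇ U b with hg
    have h1 := hc.add_inner_gradient_le hU (a + -(1 / L) • g) b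
    have h2 := le_add_inner_gradient_add_sq hU hL a (-(1 / L) • g)
    have h3 : inner ℝ (∇ U b) (a + -(1 / L) • g - b)
        = inner ℝ (∇ U b) (a - b) - 1 / L * inner ℝ (∇ U b) g := by
      rw [add_sub_right_comm, inner_add_right, inner_smul_right]; ring
    rw [h3] at h1
    rw [inner_smul_right, norm_smul, mul_pow, Real.norm_eq_abs, sq_abs] at h2
    have h4 : inner ℝ (∇ U a) g - inner ℝ (∇ U b) g = ‖g‖ ^ 2 := by
      rw [← inner_sub_left, ← hg, real_inner_self_eq_norm_sq]
    have h5 : ‖g‖ ^ 2 / (2 * L) = 1 / L * (inner ℝ (∇ U a) g - inner ℝ (∇ U b) g)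
        - L / 2 * ((-(1 / L)) ^ 2 * ‖g‖ ^ 2) := by
      rw [h4]; field_simp; ring
    rw [h5]
    linarith
  have h1 := key x y
  have h2 := key y x
  rw [norm_sub_rev] at h2
  have h3 : inner ℝ (∇ U x - ∇ U y) (x - y)
      = -inner ℝ (∇ U y) (x - y) - inner ℝ (∇ U x) (y - x) := by
    rw [inner_sub_left, ← neg_sub x y, inner_neg_right]; ring
  have h4 : ‖∇ U x - ∇ U y‖ ^ 2 / L ≤ inner ℝ (∇ U x - ∇ U y) (x - y) := by
    rw [h3]
    have : ‖∇ U x - ∇ U y‖ ^ 2 / L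
        = ‖∇ U x - ∇ U y‖ ^ 2 / (2 * L) + ‖∇ U x - ∇ U y‖ ^ 2 / (2 * L) := by
      field_simp; ring
    linarith
  rwa [div_le_iff₀' hL0] at h4

/-- A gradient step is nonexpansive, with a gain measured by the monotonicity of the gradient. -/
lemma norm_sq_gradient_step_sub_le {L γ : ℝ} (hL0 : 0 < L) (hU : Differentiable ℝ U)
    (hc : ConvexOn ℝ Set.univ U) (hL : ∀ x y, ‖∇ U x - ∇ U y‖ ≤ L * ‖x - y‖)
    (hγ : 0 ≤ γ) (hγL : γ * L ≤ 1) (x y : E) :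
    ‖(x - γ • ∇ U x) - (y - γ • ∇ U y)‖ ^ 2
      ≤ ‖x - y‖ ^ 2 - γ * inner ℝ (∇ U x - ∇ U y) (x - y) := by
  have h1 := norm_sq_gradient_sub_le hL0 hU hc hL x y
  have h2 : (x - γ • ∇ U x) - (y - γ • ∇ U y) = (x - y) - γ • (∇ U x - ∇ U y) := by
    rw [smul_sub]; abel
  rw [h2, norm_sub_sq_real, inner_smul_right, real_inner_comm, norm_smul, mul_pow,
    Real.norm_eq_abs, sq_abs]
  have h3 : 0 ≤ inner ℝ (∇ U x - ∇ U y) (x - y) := by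
    by_contra! hneg
    nlinarith [sq_nonneg ‖∇ U x - ∇ U y‖]
  nlinarith [mul_le_mul_of_nonneg_left h1 (sq_nonneg γ), mul_nonneg hγ h3]

end Smooth

/-! ### The potential -/

namespace HypH1

variable {d : ℕ} {r L c : ℝ} {U : Rd d → ℝ}

lemma differentiable (h : HypH1 r L c U) : Differentiable ℝ U :=
  h.contDiff.differentiable (by norm_num)

lemma contDiff_gradient (h : HypH1 r L c U) : ContDiff ℝ 1 (∇ U) := by
  have h1 : ContDiff ℝ 1 (fderiv ℝ U) := h.contDiff.fderiv_right (by norm_num)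
  exact (InnerProductSpace.toDual ℝ (Rd d)).symm.toContinuousLinearEquiv.contDiff.comp h1

lemma inner_hessian (h : HypH1 r L c U) (x v w : Rd d) :
    inner ℝ (hessian U x v) w = fderiv ℝ (fderiv ℝ U) x v w := by
  have h1 : HasFDerivAt (fderiv ℝ U) (fderiv ℝ (fderiv ℝ U) x) x :=
    ((h.contDiff.fderiv_right (m := 1) (by norm_num)).differentiable (by norm_num) x).hasFDerivAt
  have h2 : HasFDerivAt (∇ U) (hessian U x) x :=
    (h.contDiff_gradient.differentiable one_ne_zero x).hasFDerivAt
  have h3 := (h2.inner ℝ (hasFDerivAt_const w x)).congr_of_eventuallyEq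
    (f₁ := fun y => fderiv ℝ U y w)
    (Filter.Eventually.of_forall fun y => by
      exact ((h.differentiable y).hasGradientAt.fderiv_apply (y := w)))
  have h4 := h3.unique (h1.clm_apply (hasFDerivAt_const w x))
  simpa using congrArg (fun T => T v) h4

lemma isSymmetric_hessian (h : HypH1 r L c U) (x : Rd d) :
    (hessian U x : Rd d →ₗ[ℝ] Rd d).IsSymmetric := by
  intro v w
  have hs := (h.contDiff.contDiffAt (x := x)).isSymmSndFDerivAt (by simp) v w
  simp only [ContinuousLinearMap.coe_coe]
  rw [h.inner_hessian, real_inner_comm, h.inner_hessian, hs]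

/-- The lowest eigenvalue bounds the quadratic form of the Hessian from below. -/
lemma lowestEigenvalue_mul_norm_sq_le (h : HypH1 r L c U) (x v : Rd d) :
    lowestEigenvalue (hessian U x) * ‖v‖ ^ 2 ≤ inner ℝ (hessian U x v) v := by
  rcases eq_or_ne v 0 with rfl | hv
  · simp
  have : Nontrivial (Rd d) := ⟨⟨v, 0, hv⟩⟩
  have hT := h.isSymmetric_hessian x
  have hev := hT.hasEigenvalue_iInf_of_finiteDimensional
  set T : Rd d →ₗ[ℝ] Rd d := (hessian U x : Rd d →ₗ[ℝ] Rd d) with hTdef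
  have hfin : {μ : ℝ | Module.End.HasEigenvalue T μ}.Finite := Module.End.finite_hasEigenvalue T
  have h1 : lowestEigenvalue (hessian U x) ≤
      ⨅ w : {w : Rd d // w ≠ 0}, inner ℝ (T w) (w : Rd d) / ‖(w : Rd d)‖ ^ 2 :=
    csInf_le hfin.bddBelow hev
  have hbdd : BddBelow (Set.range fun w : {w : Rd d // w ≠ 0} =>
      inner ℝ (T w) (w : Rd d) / ‖(w : Rd d)‖ ^ 2) := by
    refine ⟨-‖hessian U x‖, ?_⟩
    rintro _ ⟨⟨w, hw⟩, rfl⟩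
    have hw' : 0 < ‖w‖ := norm_pos_iff.2 hw
    simp only
    rw [le_div_iff₀ (by positivity)]
    have h2 := abs_le.1 (abs_real_inner_le_norm (T w) w)
    have h3 : ‖T w‖ ≤ ‖hessian U x‖ * ‖w‖ := (hessian U x).le_opNorm w
    nlinarith [h2.1]
  have h2 := h1.trans (ciInf_le hbdd ⟨v, hv⟩)
  rwa [le_div_iff₀ (by positivity [norm_pos_iff.2 hv])] at h2

/-- The gradient is strongly monotone along a segment on which `U` stays below `W`. By convexity it
is enough to control `U` at the end points. -/
lemma mul_norm_sq_le_inner_gradient_sub (h : HypH1 r L c U) (hr : 0 ≤ r) {W : ℝ} {x y : Rd d}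
    (hx : U x ≤ W) (hy : U y ≤ W) :
    c * W ^ (-r) * ‖x - y‖ ^ 2 ≤ inner ℝ (∇ U x - ∇ U y) (x - y) := by
  let q : ℝ → ℝ := fun t => inner ℝ (∇ U (y + t • (x - y))) (x - y)
  have hq : ∀ t, HasDerivAt q (inner ℝ (hessian U (y + t • (x - y)) (x - y)) (x - y)) t := by
    intro t
    have h1 : HasFDerivAt (∇ U) (hessian U (y + t • (x - y))) (y + t • (x - y)) :=
      ((h.contDiff_gradient.differentiable one_ne_zero) _).hasFDerivAt
    have h2 : HasDerivAt (fun s : ℝ => y + s • (x - y)) (x - y) t := by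
      simpa using ((hasDerivAt_id t).smul_const (x - y)).const_add y
    refine ((h1.comp_hasDerivAt t h2).inner ℝ (hasDerivAt_const t (x - y))).congr_deriv ?_
    simp
  have hle : ∀ t ∈ interior (Set.Icc (0 : ℝ) 1), c * W ^ (-r) * ‖x - y‖ ^ 2 ≤ deriv q t := by
    intro t ht
    rw [interior_Icc] at ht
    rw [(hq t).deriv]
    refine le_trans ?_ (h.lowestEigenvalue_mul_norm_sq_le _ _)
    refine mul_le_mul_of_nonneg_right (le_trans ?_ (h.le_eigenvalue _)) (sq_nonneg _)
    refine mul_le_mul_of_nonneg_left ?_ h.c_pos.le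
    refine Real.rpow_le_rpow_of_nonpos (h.pos _) ?_ (by linarith)
    have h3 := h.convex.2 (Set.mem_univ y) (Set.mem_univ x) (by linarith [ht.2] : 0 ≤ 1 - t)
      ht.1.le (by ring)
    have h4 : y + t • (x - y) = (1 - t) • y + t • x := by
      rw [smul_sub, sub_smul, one_smul]; abel
    rw [h4]
    simp only [smul_eq_mul] at h3
    nlinarith [mul_le_mul_of_nonneg_left hy (by linarith [ht.2] : 0 ≤ 1 - t),
      mul_le_mul_of_nonneg_left hx ht.1.le]
  have := (convex_Icc (0 : ℝ) 1).mul_sub_le_image_sub_of_le_deriv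
    (fun t _ => (hq t).continuousAt.continuousWithinAt)
    (fun t _ => (hq t).differentiableAt.differentiableWithinAt) hle 0
    (Set.left_mem_Icc.2 zero_le_one) 1 (Set.right_mem_Icc.2 zero_le_one) zero_le_one
  simpa [q, inner_sub_left] using this

lemma one_le (h : HypH1 r L c U) (x : Rd d) : 1 ≤ U x := by
  obtain ⟨xs, h1, h2⟩ := h.exists_unique_min
  rcases eq_or_ne x xs with rfl | hx
  · exact h1.ge
  · exact (h2 x hx).le

lemma L_pos (h : HypH1 r L c U) : 0 < L := lt_of_lt_of_le one_pos h.one_le_L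

lemma gradient_eq_zero (h : HypH1 r L c U) {xs : Rd d} (hxs : U xs = 1) : ∇ U xs = 0 := by
  have hmin : IsLocalMin U xs := Filter.Eventually.of_forall fun y => hxs ▸ h.one_le y
  rw [gradient, hmin.fderiv_eq_zero, map_zero]

/-- Two gradient steps started in the sublevel set `{U ≤ W}` come closer by a factor depending
on `W`. -/
lemma norm_gradient_step_sub_le (h : HypH1 r L c U) (hr : 0 ≤ r) {γ W : ℝ} (hγ : 0 ≤ γ)
    (hγL : γ * L ≤ 1) {x y : Rd d} (hx : U x ≤ W) (hy : U y ≤ W) :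
    ‖(x - γ • ∇ U x) - (y - γ • ∇ U y)‖ ≤ Real.exp (-(γ * c * W ^ (-r) / 2)) * ‖x - y‖ := by
  have h1 := norm_sq_gradient_step_sub_le h.L_pos h.differentiable h.convex
    h.lipschitz_gradient hγ hγL x y
  have h2 := mul_le_mul_of_nonneg_left (h.mul_norm_sq_le_inner_gradient_sub hr hx hy) hγ
  refine abs_le_of_sq_le_sq' ?_ (by positivity) |>.2
  rw [mul_pow, ← Real.exp_nat_mul]
  have h3 := Real.add_one_le_exp (((2 : ℕ) : ℝ) * -(γ * c * W ^ (-r) / 2))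
  refine le_trans ?_ (mul_le_mul_of_nonneg_right h3 (sq_nonneg _))
  push_cast
  linarith

/-- One gradient step brings the squared distance to the minimizer down by at least
`γ (U x - 1)`. -/
lemma norm_sq_gradient_step_sub_min_le (h : HypH1 r L c U) {γ : ℝ} (hγ : 0 ≤ γ)
    (hγL : γ * L ≤ 1) {xs : Rd d} (hxs : U xs = 1) (x : Rd d) :
    ‖x - γ • ∇ U x - xs‖ ^ 2 ≤ ‖x - xs‖ ^ 2 - γ * (U x - 1) := by
  have h1 := norm_sq_gradient_step_sub_le h.L_pos h.differentiable h.convex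
    h.lipschitz_gradient hγ hγL x xs
  have h2 := h.convex.add_inner_gradient_le h.differentiable xs x
  rw [h.gradient_eq_zero hxs, smul_zero, sub_zero, sub_zero] at h1
  rw [← neg_sub x xs, inner_neg_right, hxs] at h2
  nlinarith [mul_le_mul_of_nonneg_left h2 hγ]

/-- The growth of `U` at infinity. -/
lemma mul_norm_sq_le (h : HypH1 r L c U) (hr : 0 ≤ r) {xs : Rd d} (hxs : U xs = 1) (x : Rd d) :
    c * ‖x - xs‖ ^ 2 ≤ 4 * U x ^ (1 + r) := by
  -- The gradient at the midpoint `m` of `xs` and `x` bounds the slope between `m` and `x`.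
  set m := xs + (2⁻¹ : ℝ) • (x - xs) with hm
  have hU0 := h.pos x
  have h1 : x - m = (2⁻¹ : ℝ) • (x - xs) := by
    rw [hm]; module
  have h2 : m - xs = (2⁻¹ : ℝ) • (x - xs) := by
    rw [hm]; module
  have hmx : U m ≤ U x := by
    have h3 := h.convex.2 (Set.mem_univ xs) (Set.mem_univ x) (by norm_num : (0 : ℝ) ≤ 2⁻¹)
      (by norm_num : (0 : ℝ) ≤ 2⁻¹) (by norm_num)
    have h4 : m = (2⁻¹ : ℝ) • xs + (2⁻¹ : ℝ) • x := by rw [hm]; module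
    rw [h4]
    simp only [smul_eq_mul, hxs] at h3
    linarith [h.one_le x]
  have h3 := h.mul_norm_sq_le_inner_gradient_sub hr hmx (hxs ▸ h.one_le x : U xs ≤ U x)
  have h4 := h.convex.add_inner_gradient_le h.differentiable x m
  rw [h.gradient_eq_zero hxs, sub_zero, h2, norm_smul, mul_pow] at h3
  rw [h1] at h4
  have h5 : ‖(2⁻¹ : ℝ)‖ ^ 2 = 1 / 4 := by norm_num
  rw [h5] at h3
  have h6 : c * U x ^ (-r) * (1 / 4 * ‖x - xs‖ ^ 2) ≤ U x := by linarith [h.pos m]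
  have h7 : U x ^ (1 + r) = U x * U x ^ r := by
    rw [Real.rpow_add hU0, Real.rpow_one]
  have h8 : U x ^ (-r) * U x ^ r = 1 := by
    rw [← Real.rpow_add hU0]; simp
  rw [h7]
  calc c * ‖x - xs‖ ^ 2
      = 4 * (c * U x ^ (-r) * (1 / 4 * ‖x - xs‖ ^ 2)) * U x ^ r := by
        linear_combination (-(c * ‖x - xs‖ ^ 2)) * h8
    _ ≤ 4 * U x * U x ^ r := by gcongr
    _ = _ := by ring

lemma c_le_L (h : HypH1 r L c U) (hd : 1 ≤ d) : c ≤ L := by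
  obtain ⟨xs, hxs, -⟩ := h.exists_unique_min
  let v : Rd d := EuclideanSpace.single ⟨0, hd⟩ 1
  have hv : ‖v‖ = 1 := by simp [v]
  have h1 := h.lowestEigenvalue_mul_norm_sq_le xs v
  have h2 := h.le_eigenvalue xs
  have h3 : ‖hessian U xs‖ ≤ L := by
    have := norm_fderiv_le_of_lipschitz ℝ (f := ∇ U) (x₀ := xs) (C := ⟨L, h.L_pos.le⟩)
      (LipschitzWith.of_dist_le_mul fun x y => by
        rw [dist_eq_norm, dist_eq_norm]; exact h.lipschitz_gradient x y)
    exact this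
  have h4 := real_inner_le_norm (hessian U xs v) v
  have h5 := (hessian U xs).le_opNorm v
  rw [hxs, Real.one_rpow] at h2
  rw [hv] at h1 h4 h5
  linarith

end HypH1

/-! ### Gaussian perturbation of a squared norm -/

/-- A second-order expansion of a power, with the remainder controlled when `t ^ 2 ≲ B * w`; the
linear term in `t` is kept, because it has mean zero in the application. -/
lemma exists_add_pow_le (q : ℕ) : ∃ C : ℝ, 0 < C ∧ ∀ B t w : ℝ, 0 ≤ B → 0 ≤ w →
    t ^ 2 ≤ 4 * (B * w) →
    (B + t + w) ^ (q + 1) ≤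
      B ^ (q + 1) + (q + 1) * B ^ q * t + C * (B ^ q * w + w ^ (q + 1)) := by
  have small : ∀ q : ℕ, ∃ C : ℝ, 0 ≤ C ∧ ∀ B N w : ℝ, 0 ≤ B → 0 ≤ w → 0 ≤ B + N →
      B + N ≤ 4 * B → N ^ 2 ≤ 10 * (B * w) →
      (B + N) ^ (q + 1) ≤ B ^ (q + 1) + (q + 1) * B ^ q * N + C * (B ^ q * w) := by
    intro q
    induction q with
    | zero => exact ⟨0, le_rfl, fun B N w _ _ _ _ _ => by simp⟩
    | succ q ih =>
      obtain ⟨C, hC, ih⟩ := ih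
      refine ⟨(q + 1) * 10 + 4 * C, by positivity, fun B N w hB hw h0 h4 hN => ?_⟩
      have h1 := mul_le_mul_of_nonneg_right (ih B N w hB hw h0 h4 hN) h0
      have h2 : (q + 1) * B ^ q * N ^ 2 ≤ (q + 1) * B ^ q * (10 * (B * w)) := by gcongr
      have h3 : C * (B ^ q * w) * (B + N) ≤ C * (B ^ q * w) * (4 * B) := by gcongr
      rw [pow_succ (B + N)]
      refine h1.trans ?_
      push_cast
      have e1 : (B ^ (q + 1) + (q + 1) * B ^ q * N + C * (B ^ q * w)) * (B + N)
        = B ^ (q + 1 + 1) + (q + 1 + 1) * B ^ (q + 1) * N + (q + 1) * B ^ q * N ^ 2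
          + C * (B ^ q * w) * (B + N) := by ring
      have e2 : (q + 1) * B ^ q * (10 * (B * w)) + C * (B ^ q * w) * (4 * B)
        = ((q + 1) * 10 + 4 * C) * (B ^ (q + 1) * w) := by ring
      rw [e1]
      linarith
  obtain ⟨C, hC, hs⟩ := small q
  refine ⟨C + (q + 1) + 4 ^ (q + 1) + 2 * (q + 1), by positivity, fun B t w hB hw ht => ?_⟩
  have hBw : 0 ≤ B ^ q * w := by positivity
  have hww : 0 ≤ w ^ (q + 1) := by positivity
  have hnn : 0 ≤ B + t + w := by
    have : (-t) ^ 2 ≤ (B + w) ^ 2 := by nlinarith [sq_nonneg (B - w)]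
    linarith [(abs_le_of_sq_le_sq' this (by positivity)).2]
  rcases le_total w B with h | h
  · have ht2 : t ≤ 2 * B :=
      (abs_le_of_sq_le_sq' (by nlinarith : t ^ 2 ≤ (2 * B) ^ 2) (by positivity)).2
    have h1 := hs B (t + w) w hB hw (by linarith) (by linarith)
      (by nlinarith [sq_nonneg (t - w), mul_le_mul_of_nonneg_right h hw])
    rw [← add_assoc] at h1
    have h2 : 0 ≤ (4 ^ (q + 1) + 2 * ((q : ℝ) + 1)) * (B ^ q * w + w ^ (q + 1)) := by positivity
    have h3 : 0 ≤ (C + (q + 1)) * w ^ (q + 1) := by positivity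
    nlinarith
  · have ht2 := abs_le_of_sq_le_sq' (by nlinarith : t ^ 2 ≤ (2 * w) ^ 2) (by positivity)
    have h1 : (B + t + w) ^ (q + 1) ≤ (4 * w) ^ (q + 1) :=
      pow_le_pow_left₀ hnn (by linarith [ht2.2]) _
    have h2 : B ^ q * -t ≤ w ^ q * (2 * w) := by
      calc B ^ q * -t ≤ B ^ q * (2 * w) := by
            refine mul_le_mul_of_nonneg_left (by linarith [ht2.1]) (by positivity)
        _ ≤ w ^ q * (2 * w) := by gcongr
    have h3 : 0 ≤ B ^ (q + 1) := by positivity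
    have h4 : 0 ≤ (C + (q + 1)) * (B ^ q * w + w ^ (q + 1)) := by positivity
    have h5 : 0 ≤ (4 ^ (q + 1) + 2 * ((q : ℝ) + 1)) * (B ^ q * w) := by positivity
    have h6 := mul_le_mul_of_nonneg_left h2 (by positivity : (0 : ℝ) ≤ q + 1)
    rw [mul_pow] at h1
    have h7 : w ^ q * (2 * w) = 2 * w ^ (q + 1) := by ring
    rw [h7] at h6
    nlinarith

lemma integrable_norm_pow_stdGaussian (d p : ℕ) :
    Integrable (fun z : Rd d => ‖z‖ ^ p) (stdGaussian (Rd d)) := by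
  have := (IsGaussian.memLp_id (stdGaussian (Rd d)) p (by simp)).integrable_norm_pow'
  simpa using this

/-- The moments of the squared norm of a standard Gaussian vector grow with the dimension `d` like
powers of `d`. -/
lemma exists_integral_norm_pow_stdGaussian_le (q : ℕ) : ∃ M : ℝ, 0 ≤ M ∧ ∀ d : ℕ,
    ∫ z : Rd d, (‖z‖ ^ 2) ^ (q + 1) ∂stdGaussian (Rd d) ≤ M * (d : ℝ) ^ (q + 1) := by
  have hint : Integrable (fun x : ℝ => (x ^ 2) ^ (q + 1)) (gaussianReal 0 1) := by
    have := (IsGaussian.memLp_id (gaussianReal 0 1) ((2 * (q + 1) : ℕ))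
      (ENNReal.natCast_ne_top _)).integrable_norm_pow'
    refine this.congr (Filter.Eventually.of_forall fun x => ?_)
    simp [pow_mul]
  refine ⟨∫ x, (x ^ 2) ^ (q + 1) ∂gaussianReal 0 1, integral_nonneg fun x => by positivity,
    fun d => ?_⟩
  rw [← map_pi_eq_stdGaussian, integral_map (by fun_prop) (by fun_prop)]
  have hcoord : ∀ i : Fin d, Integrable (fun x : Fin d → ℝ => (x i ^ 2) ^ (q + 1))
      (Measure.pi fun _ : Fin d => gaussianReal 0 1) := fun i =>
    (measurePreserving_eval (fun _ : Fin d => gaussianReal 0 1) i).integrable_comp_of_integrable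
      hint
  calc ∫ x : Fin d → ℝ, (‖WithLp.toLp 2 x‖ ^ 2) ^ (q + 1) ∂(Measure.pi fun _ => gaussianReal 0 1)
      ≤ ∫ x : Fin d → ℝ, (d : ℝ) ^ q * ∑ i, (x i ^ 2) ^ (q + 1)
          ∂(Measure.pi fun _ => gaussianReal 0 1) := by
        refine integral_mono_of_nonneg (Filter.Eventually.of_forall fun x => by positivity)
          ((integrable_finsetSum _ fun i _ => hcoord i).const_mul _)
          (Filter.Eventually.of_forall fun x => ?_)
        simp only [EuclideanSpace.real_norm_sq_eq]
        simpa using pow_sum_le_card_mul_sum_pow (s := Finset.univ) (f := fun i => x i ^ 2)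
          (fun i _ => sq_nonneg _) (n := q)
    _ = _ := by
        rw [integral_const_mul, integral_finsetSum _ fun i _ => hcoord i]
        have : ∀ i : Fin d, ∫ x : Fin d → ℝ, (x i ^ 2) ^ (q + 1)
            ∂(Measure.pi fun _ : Fin d => gaussianReal 0 1)
            = ∫ x, (x ^ 2) ^ (q + 1) ∂gaussianReal 0 1 := fun i =>
          integral_comp_eval (i := i) (μ := fun _ : Fin d => gaussianReal 0 1)
            hint.aestronglyMeasurable
        simp only [this, Finset.sum_const, Finset.card_univ, Fintype.card_fin, nsmul_eq_mul]
        ring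

/-- One Gaussian step raises the `(q + 1)`-st moment of a squared distance, to which a constant `A`
may be added, by a term of lower order. The bound depends on the noise only through its total
variance `s ^ 2 * d`. -/
lemma exists_lintegral_norm_add_pow_le (q : ℕ) : ∃ C : ℝ, 0 < C ∧
    ∀ (d : ℕ) (a : Rd d) (A s : ℝ), 0 ≤ A →
      ∫⁻ z, ENNReal.ofReal ((‖a + s • z‖ ^ 2 + A) ^ (q + 1)) ∂stdGaussian (Rd d) ≤
        ENNReal.ofReal ((‖a‖ ^ 2 + A) ^ (q + 1)
          + C * ((‖a‖ ^ 2 + A) ^ q * (s ^ 2 * d) + (s ^ 2 * d) ^ (q + 1))) := by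
  obtain ⟨C, hC, hpow⟩ := exists_add_pow_le q
  obtain ⟨M, hM, hmom⟩ := exists_integral_norm_pow_stdGaussian_le q
  obtain ⟨M', hM', hmom'⟩ := exists_integral_norm_pow_stdGaussian_le 0
  refine ⟨C * (M' + M + 1), by positivity, fun d a A s hA => ?_⟩
  set B := ‖a‖ ^ 2 + A with hB
  have hB0 : 0 ≤ B := by positivity
  let R : Rd d → ℝ := fun z => B ^ (q + 1) + (q + 1) * B ^ q * (2 * s) * inner ℝ a z
    + (C * (B ^ q * s ^ 2) * ‖z‖ ^ 2 + C * (s ^ 2) ^ (q + 1) * (‖z‖ ^ 2) ^ (q + 1))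
  have hle : ∀ z : Rd d, (‖a + s • z‖ ^ 2 + A) ^ (q + 1) ≤ R z := by
    intro z
    have h1 := hpow B (2 * s * inner ℝ a z) (s ^ 2 * ‖z‖ ^ 2) hB0 (by positivity) (by
      have h2 : inner ℝ a z ^ 2 ≤ ‖a‖ ^ 2 * ‖z‖ ^ 2 := by
        rw [← mul_pow]; exact sq_le_sq' (by linarith [abs_le.1 (abs_real_inner_le_norm a z)])
          (real_inner_le_norm a z)
      have h3 : inner ℝ a z ^ 2 ≤ B * ‖z‖ ^ 2 :=
        h2.trans (by gcongr; linarith)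
      nlinarith [mul_le_mul_of_nonneg_left h3 (sq_nonneg s)])
    have h2 : ‖a + s • z‖ ^ 2 + A = B + 2 * s * inner ℝ a z + s ^ 2 * ‖z‖ ^ 2 := by
      rw [norm_add_sq_real, inner_smul_right, norm_smul, mul_pow, Real.norm_eq_abs, sq_abs]
      ring
    rw [h2]
    refine h1.trans (le_of_eq ?_)
    simp only [R]
    ring
  have i1 : Integrable (fun z : Rd d => inner ℝ a z) (stdGaussian (Rd d)) :=
    (innerSL ℝ a).integrable_comp IsGaussian.integrable_id
  have i2 := integrable_norm_pow_stdGaussian d 2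
  have i3 : Integrable (fun z : Rd d => (‖z‖ ^ 2) ^ (q + 1)) (stdGaussian (Rd d)) := by
    simpa [pow_mul] using integrable_norm_pow_stdGaussian d (2 * (q + 1))
  have iR : Integrable R (stdGaussian (Rd d)) :=
    ((integrable_const _).add (i1.const_mul _)).add ((i2.const_mul _).add (i3.const_mul _))
  have hmean : ∫ z : Rd d, inner ℝ a z ∂stdGaussian (Rd d) = 0 :=
    integral_strongDual_stdGaussian (innerSL ℝ a)
  calc ∫⁻ z, ENNReal.ofReal ((‖a + s • z‖ ^ 2 + A) ^ (q + 1)) ∂stdGaussian (Rd d)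
      ≤ ∫⁻ z, ENNReal.ofReal (R z) ∂stdGaussian (Rd d) :=
        lintegral_mono fun z => ENNReal.ofReal_le_ofReal (hle z)
    _ = ENNReal.ofReal (∫ z, R z ∂stdGaussian (Rd d)) :=
        (ofReal_integral_eq_lintegral_ofReal iR (Filter.Eventually.of_forall fun z =>
          le_trans (by positivity) (hle z))).symm
    _ ≤ _ := by
        refine ENNReal.ofReal_le_ofReal ?_
        have e : ∫ z, R z ∂stdGaussian (Rd d) = B ^ (q + 1)
            + (C * (B ^ q * s ^ 2) * ∫ z : Rd d, ‖z‖ ^ 2 ∂stdGaussian (Rd d)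
              + C * (s ^ 2) ^ (q + 1) * ∫ z : Rd d, (‖z‖ ^ 2) ^ (q + 1) ∂stdGaussian (Rd d)) := by
          simp only [R]
          rw [integral_add, integral_add, integral_add, integral_const_mul, integral_const_mul,
            integral_const_mul, hmean]
          · simp
          all_goals first
            | exact integrable_const _
            | exact i1.const_mul _
            | exact i2.const_mul _
            | exact i3.const_mul _
            | exact (integrable_const _).add (i1.const_mul _)
            | exact (i2.const_mul _).add (i3.const_mul _)
        rw [e]
        have h2 := hmom' d
        simp only [zero_add, pow_one] at h2
        have h3 := mul_le_mul_of_nonneg_left h2 (by positivity : 0 ≤ C * (B ^ q * s ^ 2))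
        have h4 := mul_le_mul_of_nonneg_left (hmom d) (by positivity : 0 ≤ C * (s ^ 2) ^ (q + 1))
        have h5 : C * (B ^ q * s ^ 2) * (M' * d) = C * M' * (B ^ q * (s ^ 2 * d)) := by ring
        have h6 : C * (s ^ 2) ^ (q + 1) * (M * (d : ℝ) ^ (q + 1))
            = C * M * (s ^ 2 * d) ^ (q + 1) := by ring
        rw [h5] at h3
        rw [h6] at h4
        have h7 : 0 ≤ B ^ q * (s ^ 2 * d) := by positivity
        have h8 : 0 ≤ (s ^ 2 * d) ^ (q + 1) := by positivity
        have h9 : 0 ≤ C * (M + 1) * (B ^ q * (s ^ 2 * d)) := by positivity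
        have h10 : 0 ≤ C * (M' + 1) * (s ^ 2 * d) ^ (q + 1) := by positivity
        linarith

/-! ### The Euler scheme on the space of noise sequences -/

/-- The law of an i.i.d. sequence of standard Gaussian vectors of `ℝ^d`. -/
def noiseLaw (d : ℕ) : Measure (ℕ → Rd d) :=
  Measure.infinitePi fun _ => stdGaussian (Rd d)

instance (d : ℕ) : IsProbabilityMeasure (noiseLaw d) := by
  unfold noiseLaw; infer_instance

/-- The Euler scheme as a function of its starting point and of the whole noise sequence. -/
def chain {d : ℕ} (U : Rd d → ℝ) (σ γ : ℝ) (n : ℕ) (x : Rd d) (z : ℕ → Rd d) : Rd d :=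
  eulerScheme U σ γ (fun k (w : ℕ → Rd d) => w k) x n z

/-- The events that depend on the noise up to time `n` only. -/
abbrev noisePast (d n : ℕ) : MeasurableSpace (ℕ → Rd d) :=
  Filtration.natural (fun k (z : ℕ → Rd d) => z k)
    (fun k => (measurable_pi_apply k).stronglyMeasurable) n

section Chain

variable {d : ℕ} {U : Rd d → ℝ} {σ γ : ℝ}

@[simp] lemma chain_zero (x : Rd d) (z : ℕ → Rd d) : chain U σ γ 0 x z = x := rfl

lemma chain_succ (n : ℕ) (x : Rd d) (z : ℕ → Rd d) :
    chain U σ γ (n + 1) x z =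
      chain U σ γ n x z - γ • ∇ U (chain U σ γ n x z) + (σ * √γ) • z (n + 1) := rfl

lemma eulerScheme_eq_chain {Ω : Type*} (Z : ℕ → Ω → Rd d) (x : Rd d) (n : ℕ) (ω : Ω) :
    eulerScheme U σ γ Z x n ω = chain U σ γ n x (fun k => Z k ω) := by
  induction n with
  | zero => rfl
  | succ n ih => rw [chain_succ, ← ih]; rfl

lemma measurable_eulerStep (hU : Measurable (∇ U)) :
    Measurable fun p : Rd d × Rd d => p.1 - γ • ∇ U p.1 + (σ * √γ) • p.2 := by
  have h1 : Measurable fun p : Rd d × Rd d => ∇ U p.1 := hU.comp measurable_fst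
  fun_prop

lemma measurable_chain_uncurry (hU : Measurable (∇ U)) (n : ℕ) :
    Measurable fun p : Rd d × (ℕ → Rd d) => chain U σ γ n p.1 p.2 := by
  induction n with
  | zero => exact measurable_fst
  | succ n ih =>
    exact (measurable_eulerStep hU).comp
      (ih.prodMk ((measurable_pi_apply (n + 1)).comp measurable_snd))

lemma measurable_chain (hU : Measurable (∇ U)) (n : ℕ) (x : Rd d) :
    Measurable (chain U σ γ n x) :=
  (measurable_chain_uncurry hU n).comp measurable_prodMk_left

lemma noisePast_mono {m n : ℕ} (h : m ≤ n) : noisePast d m ≤ noisePast d n :=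
  (Filtration.natural _ _).mono h

lemma noisePast_le (n : ℕ) : noisePast d n ≤ MeasurableSpace.pi :=
  (Filtration.natural _ _).le n

lemma measurable_chain_noisePast (hU : Measurable (∇ U)) (x : Rd d) {n m : ℕ} (hnm : n ≤ m) :
    Measurable[noisePast d m] (chain U σ γ n x) := by
  suffices Measurable[noisePast d n] (chain U σ γ n x) from this.mono (noisePast_mono hnm) le_rfl
  induction n with
  | zero => exact measurable_const
  | succ n ih =>
    have h1 : Measurable[noisePast d (n + 1)] (chain U σ γ n x) :=
      (ih (by omega)).mono (noisePast_mono n.le_succ) le_rfl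
    have h2 : Measurable[noisePast d (n + 1)] (fun z : ℕ → Rd d => z (n + 1)) :=
      (Filtration.stronglyAdapted_natural (β := fun _ => Rd d)
        (fun k => (measurable_pi_apply k).stronglyMeasurable) (n + 1)).measurable
    exact (measurable_eulerStep hU).comp (h1.prodMk h2)

/-- The Markov property: the noise at time `n + 1` is independent of the past and can be integrated
out first. -/
lemma lintegral_noise_succ {E : Type*} [MeasurableSpace E] {n : ℕ} {H : (ℕ → Rd d) → E}
    (hH : Measurable[noisePast d n] H) {G : E × Rd d → ENNReal} (hG : Measurable G) :
    ∫⁻ z, G (H z, z (n + 1)) ∂noiseLaw d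
      = ∫⁻ z, ∫⁻ y, G (H z, y) ∂stdGaussian (Rd d) ∂noiseLaw d := by
  have hind : IndepFun H (fun z : ℕ → Rd d => z (n + 1)) (noiseLaw d) := by
    have h1 : iIndepFun (fun k (z : ℕ → Rd d) => z k) (noiseLaw d) :=
      iIndepFun_infinitePi (X := fun _ y => y) (fun _ => measurable_id)
    have h2 := h1.indep_comap_natural_of_lt
      (fun k => (measurable_pi_apply k).stronglyMeasurable) n.lt_succ_self
    exact (indep_of_indep_of_le_right h2 hH.comap_le).symm
  have hH' : Measurable H := hH.mono (noisePast_le n) le_rfl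
  have hmap := (indepFun_iff_map_prod_eq_prod_map_map hH'.aemeasurable
    (measurable_pi_apply (n + 1)).aemeasurable).1 hind
  have hZ : (noiseLaw d).map (fun z : ℕ → Rd d => z (n + 1)) = stdGaussian (Rd d) :=
    Measure.infinitePi_map_eval _ _
  rw [hZ] at hmap
  have : IsProbabilityMeasure ((noiseLaw d).map H) :=
    Measure.isProbabilityMeasure_map hH'.aemeasurable
  calc ∫⁻ z, G (H z, z (n + 1)) ∂noiseLaw d
      = ∫⁻ p, G p ∂(noiseLaw d).map (fun z => (H z, z (n + 1))) :=
        (lintegral_map hG (hH'.prodMk (measurable_pi_apply (n + 1)))).symm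
    _ = ∫⁻ e, ∫⁻ y, G (e, y) ∂stdGaussian (Rd d) ∂(noiseLaw d).map H := by
        rw [hmap, lintegral_prod _ hG.aemeasurable]
    _ = _ := lintegral_map hG.lintegral_prod_right' hH'

/-- The Markov property for the next state of the chain. -/
lemma lintegral_chain_succ (hU : Measurable (∇ U)) (n : ℕ) (x : Rd d) {g : Rd d → ENNReal}
    (hg : Measurable g) :
    ∫⁻ z, g (chain U σ γ (n + 1) x z) ∂noiseLaw d
      = ∫⁻ z, ∫⁻ y, g (chain U σ γ n x z - γ • ∇ U (chain U σ γ n x z) + (σ * √γ) • y)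
          ∂stdGaussian (Rd d) ∂noiseLaw d := by
  exact lintegral_noise_succ (measurable_chain_noisePast hU x le_rfl)
    (hg.comp (measurable_eulerStep hU))

end Chain

/-! ### Moments of the additive functional -/

namespace HypH1

variable {d : ℕ} {r L c : ℝ} {U : Rd d → ℝ}

lemma continuous (h : HypH1 r L c U) : Continuous U := h.contDiff.continuous

lemma measurable_gradient (h : HypH1 r L c U) : Measurable (∇ U) :=
  h.contDiff_gradient.continuous.measurable

end HypH1

/-- The time integral of `U - 1` along the first `n` steps of the chain. -/
def excess {d : ℕ} (U : Rd d → ℝ) (σ γ : ℝ) (n : ℕ) (x : Rd d) (z : ℕ → Rd d) : ℝ :=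
  γ * ∑ k ∈ Finset.range n, (U (chain U σ γ k x z) - 1)

section Excess

variable {d : ℕ} {r L c : ℝ} {U : Rd d → ℝ}

lemma excess_succ {σ γ : ℝ} (n : ℕ) (x : Rd d) (z : ℕ → Rd d) :
    excess U σ γ (n + 1) x z
      = excess U σ γ n x z + γ * (U (chain U σ γ n x z) - 1) := by
  rw [excess, excess, Finset.sum_range_succ, mul_add]

lemma excess_nonneg (h : HypH1 r L c U) {σ γ : ℝ} (hγ : 0 ≤ γ) (n : ℕ) (x : Rd d)
    (z : ℕ → Rd d) : 0 ≤ excess U σ γ n x z :=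
  mul_nonneg hγ (Finset.sum_nonneg fun _ _ => sub_nonneg.2 (h.one_le _))

lemma measurable_excess_noisePast (h : HypH1 r L c U) {σ γ : ℝ} {n m : ℕ} (hnm : n ≤ m + 1)
    (x : Rd d) : Measurable[noisePast d m] (excess U σ γ n x) := by
  refine Measurable.const_mul (Finset.measurable_sum _ fun k hk => ?_) γ
  have hk' : k ≤ m := by have := Finset.mem_range.1 hk; omega
  exact (h.continuous.measurable.comp
    (measurable_chain_noisePast h.measurable_gradient x hk')).sub_const 1

lemma measurable_excess (h : HypH1 r L c U) {σ γ : ℝ} (n : ℕ) (x : Rd d) :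
    Measurable (excess U σ γ n x) :=
  (measurable_excess_noisePast h n.le_succ x).mono (noisePast_le n) le_rfl

/-- One step for the sum of the squared distance to the minimizer and of the time integral of
`U - 1`. The drift of the former compensates the growth of the latter, and since the variance of
the noise is at most proportional to the sum itself, only terms of lower order remain. -/
lemma exists_lintegral_sq_add_excess_succ_le (q : ℕ) : ∃ C : ℝ, 0 < C ∧
    ∀ (d : ℕ) (r L c σ γ : ℝ) (U : Rd d → ℝ) (xs x : Rd d), HypH1 r L c U → U xs = 1 →
      0 ≤ γ → γ * L ≤ 1 → ∀ n : ℕ,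
      ∫⁻ z, ENNReal.ofReal
          ((‖chain U σ γ (n + 1) x z - xs‖ ^ 2 + excess U σ γ (n + 1) x z) ^ (q + 1)) ∂noiseLaw d
        ≤ ∫⁻ z, ENNReal.ofReal
          ((‖chain U σ γ n x z - xs‖ ^ 2 + excess U σ γ n x z) ^ (q + 1)
            + C * ((‖chain U σ γ n x z - xs‖ ^ 2 + excess U σ γ n x z) ^ q * (γ * σ ^ 2 * d)
              + (γ * σ ^ 2 * d) ^ (q + 1))) ∂noiseLaw d := by
  obtain ⟨C, hC, hstep⟩ := exists_lintegral_norm_add_pow_le q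
  refine ⟨C, hC, fun d r L c σ γ U xs x h hxs hγ hγL n => ?_⟩
  let H : (ℕ → Rd d) → Rd d × ℝ := fun z => (chain U σ γ n x z, excess U σ γ (n + 1) x z)
  have hH : Measurable[noisePast d n] H :=
    (measurable_chain_noisePast h.measurable_gradient x le_rfl).prodMk
      (measurable_excess_noisePast h le_rfl x)
  let G : (Rd d × ℝ) × Rd d → ENNReal := fun p => ENNReal.ofReal
    ((‖(p.1.1 - γ • ∇ U p.1.1 - xs) + (σ * √γ) • p.2‖ ^ 2 + p.1.2) ^ (q + 1))
  have hG : Measurable G := by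
    have hg := h.measurable_gradient
    have : Measurable fun p : (Rd d × ℝ) × Rd d => ∇ U p.1.1 :=
      hg.comp (measurable_fst.comp measurable_fst)
    fun_prop
  have h1 := lintegral_noise_succ hH hG
  have h2 : ∀ z, G (H z, z (n + 1)) = ENNReal.ofReal
      ((‖chain U σ γ (n + 1) x z - xs‖ ^ 2 + excess U σ γ (n + 1) x z) ^ (q + 1)) := by
    intro z
    simp only [G, H, chain_succ]
    rw [sub_add_eq_add_sub]
  simp only [h2] at h1
  rw [h1]
  refine lintegral_mono fun z => ?_
  refine (hstep d (chain U σ γ n x z - γ • ∇ U (chain U σ γ n x z) - xs)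
    (excess U σ γ (n + 1) x z) (σ * √γ) (excess_nonneg h hγ (n + 1) x z)).trans ?_
  refine ENNReal.ofReal_le_ofReal ?_
  have h3 : (σ * √γ) ^ 2 * d = γ * σ ^ 2 * d := by
    rw [mul_pow, Real.sq_sqrt hγ]; ring
  have h4 := h.norm_sq_gradient_step_sub_min_le hγ hγL hxs (chain U σ γ n x z)
  have h5 : ‖chain U σ γ n x z - γ • ∇ U (chain U σ γ n x z) - xs‖ ^ 2
      + excess U σ γ (n + 1) x z
      ≤ ‖chain U σ γ n x z - xs‖ ^ 2 + excess U σ γ n x z := by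
    rw [excess_succ]; linarith
  have h6 := excess_nonneg (σ := σ) h hγ (n + 1) x z
  rw [h3]
  gcongr

/-- The time integral of `U - 1` along the chain has moments that grow at most linearly in time, in
the sense of `L^p` norms, at the rate given by the variance of the noise. -/
lemma exists_lintegral_sq_add_excess_le (p : ℕ) : ∃ C : ℝ, 0 < C ∧
    ∀ (d : ℕ) (r L c σ γ : ℝ) (U : Rd d → ℝ) (xs x : Rd d), HypH1 r L c U → U xs = 1 →
      0 ≤ γ → γ * L ≤ 1 → ∀ n : ℕ,
      ∫⁻ z, ENNReal.ofReal ((‖chain U σ γ n x z - xs‖ ^ 2 + excess U σ γ n x z) ^ p) ∂noiseLaw d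
        ≤ ENNReal.ofReal (C * (‖x - xs‖ ^ 2 + n * (γ * σ ^ 2 * d)) ^ p) := by
  induction p with
  | zero => exact ⟨1, one_pos, fun d r L c σ γ U xs x h hxs hγ hγL n => by simp⟩
  | succ q ih =>
    obtain ⟨C', hC', ih⟩ := ih
    obtain ⟨C, hC, hstep⟩ := exists_lintegral_sq_add_excess_succ_le q
    refine ⟨1 + C * (C' + 1), by positivity, fun d r L c σ γ U xs x h hxs hγ hγL n => ?_⟩
    set u := γ * σ ^ 2 * d with hu
    set V := ‖x - xs‖ ^ 2 with hV
    have hu0 : 0 ≤ u := by positivity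
    have hV0 : 0 ≤ V := by positivity
    have key : ∀ n : ℕ, ∫⁻ z, ENNReal.ofReal
        ((‖chain U σ γ n x z - xs‖ ^ 2 + excess U σ γ n x z) ^ (q + 1)) ∂noiseLaw d
        ≤ ENNReal.ofReal (V ^ (q + 1) + n * (C * (C' + 1)) * u * (V + n * u) ^ q) := by
      intro n
      induction n with
      | zero => simp [excess, V]
      | succ n ihn =>
        refine (hstep d r L c σ γ U xs x h hxs hγ hγL n).trans ?_
        set S : (ℕ → Rd d) → ℝ :=
          fun z => ‖chain U σ γ n x z - xs‖ ^ 2 + excess U σ γ n x z with hS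
        have hS0 : ∀ z, 0 ≤ S z := fun z =>
          add_nonneg (sq_nonneg _) (excess_nonneg h hγ n x z)
        have hSm : Measurable S :=
          (((measurable_chain h.measurable_gradient n x).sub_const xs).norm.pow_const 2).add
            (measurable_excess h n x)
        have e1 : ∀ z, ENNReal.ofReal (S z ^ (q + 1) + C * (S z ^ q * u + u ^ (q + 1)))
            = ENNReal.ofReal (S z ^ (q + 1)) + ENNReal.ofReal (C * u) * ENNReal.ofReal (S z ^ q)
              + ENNReal.ofReal (C * u ^ (q + 1)) := by
          intro z
          have := hS0 z
          rw [← ENNReal.ofReal_mul (by positivity), ← ENNReal.ofReal_add (by positivity)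
            (by positivity), ← ENNReal.ofReal_add (by positivity) (by positivity)]
          congr 1; ring
        change ∫⁻ z, ENNReal.ofReal (S z ^ (q + 1) + C * (S z ^ q * u + u ^ (q + 1)))
          ∂noiseLaw d ≤ _
        simp only [e1]
        rw [lintegral_add_right _ measurable_const, lintegral_add_left
          (hSm.pow_const _).ennreal_ofReal, lintegral_const_mul _ (hSm.pow_const _).ennreal_ofReal,
          lintegral_const, measure_univ, mul_one]
        refine (add_le_add_left (add_le_add ihn (mul_le_mul_right
          (ih d r L c σ γ U xs x h hxs hγ hγL n) _)) _).trans ?_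
        rw [← ENNReal.ofReal_mul (by positivity), ← ENNReal.ofReal_add (by positivity)
          (by positivity), ← ENNReal.ofReal_add (by positivity) (by positivity)]
        refine ENNReal.ofReal_le_ofReal ?_
        push_cast
        have m1 : (V + n * u) ^ q ≤ (V + (n + 1) * u) ^ q := by gcongr; linarith
        have m2 : u ^ q ≤ (V + (n + 1) * u) ^ q := by
          gcongr
          nlinarith [mul_nonneg (Nat.cast_nonneg (α := ℝ) n) hu0]
        calc V ^ (q + 1) + n * (C * (C' + 1)) * u * (V + n * u) ^ q
              + C * u * (C' * (V + n * u) ^ q) + C * u ^ (q + 1)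
            = V ^ (q + 1) + (n * (C * (C' + 1)) * u + C * u * C') * (V + n * u) ^ q
              + C * u * u ^ q := by ring
          _ ≤ V ^ (q + 1) + (n * (C * (C' + 1)) * u + C * u * C') * (V + (n + 1) * u) ^ q
              + C * u * (V + (n + 1) * u) ^ q := by gcongr
          _ = _ := by ring
    refine (key n).trans (ENNReal.ofReal_le_ofReal ?_)
    have m1 : V ^ (q + 1) ≤ (V + n * u) ^ (q + 1) := by
      gcongr; nlinarith [mul_nonneg (Nat.cast_nonneg (α := ℝ) n) hu0]
    have m2 : n * u ≤ V + n * u := by linarith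
    calc V ^ (q + 1) + n * (C * (C' + 1)) * u * (V + n * u) ^ q
        = V ^ (q + 1) + C * (C' + 1) * ((n * u) * (V + n * u) ^ q) := by ring
      _ ≤ (V + n * u) ^ (q + 1) + C * (C' + 1) * ((V + n * u) * (V + n * u) ^ q) := by gcongr
      _ = _ := by ring

end Excess

/-! ### A Lyapunov inequality for the distance to the minimizer -/

/-- The squared distance to `xs`, measured in the unit `Ψ ^ (1 + r) / c`: by the growth of `U`, this
is the squared diameter of the sublevel set `{U ≤ Ψ}`, up to a constant. -/
def scaledSqDist {d : ℕ} (r c Ψ : ℝ) (xs x : Rd d) : ℝ :=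
  c * ‖x - xs‖ ^ 2 / Ψ ^ (1 + r)

lemma measurable_scaledSqDist {d : ℕ} (r c Ψ : ℝ) (xs : Rd d) :
    Measurable (scaledSqDist r c Ψ xs) := by
  unfold scaledSqDist; fun_prop

lemma continuous_scaledSqDist {d : ℕ} (r c Ψ : ℝ) (xs : Rd d) :
    Continuous (scaledSqDist r c Ψ xs) := by
  unfold scaledSqDist; fun_prop

lemma scaledSqDist_nonneg {d : ℕ} {r c Ψ : ℝ} (hc : 0 ≤ c) (hΨ : 0 ≤ Ψ) (xs x : Rd d) :
    0 ≤ scaledSqDist r c Ψ xs x := by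
  unfold scaledSqDist; positivity

/-- The scalar inequality behind the Lyapunov estimate. Here `y` stands for `U / Ψ` and `v` for the
scaled squared distance; the drift `-ε y` beats the other terms as soon as `y` exceeds a constant,
and otherwise `v` is bounded. -/
lemma exists_lyapunov_bound (q : ℕ) {a C : ℝ} (ha : 0 < a) (hC : 0 < C) :
    ∃ C' : ℝ, 0 < C' ∧ ∀ r ε b v w y ρ : ℝ, 0 ≤ r → r ≤ 1 → 0 ≤ ε → ε ≤ 1 / a → 0 ≤ b →
      b ≤ v - ε * (y - ρ) → 0 ≤ ρ → ρ ≤ y → ρ ≤ 1 / a → v ≤ 4 * y ^ (1 + r) → 0 ≤ w →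
      w ≤ ε / a →
      b ^ (q + 1) + C * (b ^ q * w + w ^ (q + 1)) + ε * v ^ q ≤ v ^ (q + 1) + ε * C' := by
  set k : ℝ := 1 / a + C / a + 1 with hk
  have hk1 : 1 ≤ k := by rw [hk]; linarith [div_pos one_pos ha, div_pos hC ha]
  set C₁ : ℝ := C * (1 / a * (1 / a / a) ^ q) with hC₁
  refine ⟨(4 * k ^ 2) ^ q * k + C₁, by positivity, ?_⟩
  intro r ε b v w y ρ hr hr1 hε hεa hb hbv hρ hρy hρa hvy hw hwε
  have hy : 0 ≤ y := hρ.trans hρy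
  have hv : b ≤ v := hbv.trans (by nlinarith [mul_nonneg hε (sub_nonneg.2 hρy)])
  have hv0 : 0 ≤ v := hb.trans hv
  have hbq : b ^ q ≤ v ^ q := by gcongr
  have h1 : b ^ (q + 1) ≤ (v - ε * (y - ρ)) * v ^ q := by
    rw [pow_succ']; exact mul_le_mul hbv hbq (by positivity) (hb.trans hbv)
  have h2 : b ^ q * w ≤ v ^ q * (ε / a) := mul_le_mul hbq hwε hw (by positivity)
  have h3 : C * w ^ (q + 1) ≤ ε * C₁ := by
    have : w ≤ 1 / a / a := hwε.trans (by gcongr)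
    rw [pow_succ']
    calc C * (w * w ^ q) ≤ C * (ε / a * (1 / a / a) ^ q) := by gcongr
      _ = ε * C₁ := by rw [hC₁]; ring
  have h4 : v ^ q * (k - y) ≤ (4 * k ^ 2) ^ q * k := by
    rcases le_total k y with hky | hky
    · exact le_trans (mul_nonpos_of_nonneg_of_nonpos (by positivity) (by linarith))
        (by positivity)
    · have h5 : v ≤ 4 * k ^ 2 := by
        refine hvy.trans ?_
        have h6 : y ^ (1 + r) ≤ k ^ (1 + r) := Real.rpow_le_rpow hy hky (by linarith)
        have h7 : k ^ (1 + r) ≤ k ^ (2 : ℝ) :=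
          Real.rpow_le_rpow_of_exponent_le hk1 (by linarith)
        rw [Real.rpow_two] at h7
        linarith
      have h8 : v ^ q ≤ (4 * k ^ 2) ^ q := by gcongr
      exact mul_le_mul h8 (by linarith) (by linarith) (by positivity)
  have h5 : ε * (v ^ q * ρ) ≤ ε * (v ^ q * (1 / a)) := by gcongr
  have h6 := mul_le_mul_of_nonneg_left h4 hε
  have h7 := mul_le_mul_of_nonneg_left h2 hC.le
  have e1 : ε * (v ^ q * (k - y)) = ε * (v ^ q * (1 / a)) + C * (v ^ q * (ε / a)) + ε * v ^ q
      - ε * (v ^ q * y) := by rw [hk]; ring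
  have e2 : (v - ε * (y - ρ)) * v ^ q = v ^ (q + 1) - ε * (v ^ q * y) + ε * (v ^ q * ρ) := by
    ring
  rw [e1] at h6
  rw [e2] at h1
  linarith

lemma scale_le_of_mul_le {d : ℕ} {a σ Ψ : ℝ} (hd : 1 ≤ d) (ha : 0 < a)
    (hΨ : a * (d * (1 + σ ^ 2)) ≤ Ψ) : a ≤ Ψ := by
  have hd' : (1 : ℝ) ≤ d := by exact_mod_cast hd
  have : (1 : ℝ) ≤ d * (1 + σ ^ 2) := by nlinarith [sq_nonneg σ]
  nlinarith

/-- The powers of the scaled squared distance are Lyapunov functions for the chain. The drift is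
proportional to `γ c Ψ ^ (-r)`, the length of a time step in the unit `Ψ ^ r / c`, and the other
constant does not depend on the data. -/
lemma exists_lintegral_scaledSqDist_succ_le (q : ℕ) {a : ℝ} (ha : 0 < a) (ha1 : a ≤ 1) :
    ∃ C : ℝ, 0 < C ∧ ∀ (d : ℕ) (r L c σ γ Ψ : ℝ) (U : Rd d → ℝ) (xs x : Rd d), 1 ≤ d →
      HypH1 r L c U → U xs = 1 → 0 ≤ r → r < 1 → 0 < γ → γ * L ≤ 1 →
      a * (d * (1 + σ ^ 2)) ≤ Ψ → ∀ n : ℕ,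
      ∫⁻ z, ENNReal.ofReal (scaledSqDist r c Ψ xs (chain U σ γ (n + 1) x z) ^ (q + 1)) ∂noiseLaw d
        + ENNReal.ofReal (γ * c * Ψ ^ (-r)) *
          ∫⁻ z, ENNReal.ofReal (scaledSqDist r c Ψ xs (chain U σ γ n x z) ^ q) ∂noiseLaw d
        ≤ ∫⁻ z, ENNReal.ofReal (scaledSqDist r c Ψ xs (chain U σ γ n x z) ^ (q + 1)) ∂noiseLaw d
          + ENNReal.ofReal (γ * c * Ψ ^ (-r)) * ENNReal.ofReal C := by
  obtain ⟨C, hC, hstep⟩ := exists_lintegral_norm_add_pow_le q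
  obtain ⟨C', hC', hlyap⟩ := exists_lyapunov_bound q ha hC
  refine ⟨C', hC', fun d r L c σ γ Ψ U xs x hd h hxs hr hr1 hγ hγL hΨ n => ?_⟩
  have haΨ : a ≤ Ψ := scale_le_of_mul_le hd ha hΨ
  have hΨ0 : 0 < Ψ := ha.trans_le haΨ
  have hc := h.c_pos
  have hD : 0 < Ψ ^ (1 + r) := Real.rpow_pos_of_pos hΨ0 _
  have hDr : 0 < Ψ ^ (-r) := Real.rpow_pos_of_pos hΨ0 _
  have hprod : Ψ ^ (1 + r) * Ψ ^ (-r) = Ψ := by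
    rw [← Real.rpow_add hΨ0]; simp
  set ε := γ * c * Ψ ^ (-r) with hε
  have hε0 : 0 < ε := by positivity
  have hεΨ : ε * Ψ ^ (1 + r) = γ * c * Ψ := by rw [hε, mul_assoc, mul_comm (Ψ ^ (-r)), hprod]
  have hεa : ε ≤ 1 / a := by
    have h1 : γ * c ≤ 1 := le_trans (by gcongr; exact h.c_le_L hd) hγL
    have h2 : Ψ ^ (-r) ≤ a ^ (-r) := Real.rpow_le_rpow_of_nonpos ha haΨ (by linarith)
    have h3 : a ^ (-r) ≤ a ^ (-1 : ℝ) :=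
      Real.rpow_le_rpow_of_exponent_ge ha ha1 (by linarith)
    rw [Real.rpow_neg_one, ← one_div] at h3
    calc ε = γ * c * Ψ ^ (-r) := hε
      _ ≤ 1 * Ψ ^ (-r) := by gcongr
      _ ≤ 1 / a := by linarith
  set v := scaledSqDist r c Ψ xs with hv
  have hvm : Measurable v := measurable_scaledSqDist r c Ψ xs
  have hv0 : ∀ y, 0 ≤ v y := scaledSqDist_nonneg hc.le hΨ0.le xs
  have hcm := measurable_chain (σ := σ) (γ := γ) h.measurable_gradient n x
  -- The inequality conditionally on the present state `y`.
  have key : ∀ y : Rd d, ∫⁻ w, ENNReal.ofReal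
        (v (y - γ • ∇ U y + (σ * √γ) • w) ^ (q + 1)) ∂stdGaussian (Rd d)
      + ENNReal.ofReal ε * ENNReal.ofReal (v y ^ q)
      ≤ ENNReal.ofReal (v y ^ (q + 1)) + ENNReal.ofReal ε * ENNReal.ofReal C' := by
    intro y
    set η := √(c / Ψ ^ (1 + r)) with hη
    have hη2 : η ^ 2 = c / Ψ ^ (1 + r) := Real.sq_sqrt (by positivity)
    have e0 : ∀ p : Rd d, ‖η • p‖ ^ 2 = c * ‖p‖ ^ 2 / Ψ ^ (1 + r) := by
      intro p
      rw [norm_smul, mul_pow, Real.norm_eq_abs, sq_abs, hη2]; ring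
    have e1 : ∀ w : Rd d, v (y - γ • ∇ U y + (σ * √γ) • w)
        = ‖η • (y - γ • ∇ U y - xs) + (η * (σ * √γ)) • w‖ ^ 2 + 0 := by
      intro w
      rw [mul_smul η, ← smul_add, e0, hv, scaledSqDist, add_zero,
        sub_add_eq_add_sub (y - γ • ∇ U y)]
    have h1 := hstep d (η • (y - γ • ∇ U y - xs)) 0 (η * (σ * √γ)) le_rfl
    simp only [← e1, add_zero] at h1
    have e2 : (η * (σ * √γ)) ^ 2 * d = γ * σ ^ 2 * d * c / Ψ ^ (1 + r) := by
      rw [mul_pow, mul_pow, Real.sq_sqrt hγ.le, hη2]; ring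
    rw [e0, e2] at h1
    have hU0 := h.pos y
    have h2 := hlyap r ε (c * ‖y - γ • ∇ U y - xs‖ ^ 2 / Ψ ^ (1 + r)) (v y)
      (γ * σ ^ 2 * d * c / Ψ ^ (1 + r)) (U y / Ψ) (1 / Ψ) hr hr1.le hε0.le hεa (by positivity)
      (by
        have h3 := h.norm_sq_gradient_step_sub_min_le hγ.le hγL hxs y
        rw [hv, scaledSqDist, div_le_iff₀ hD, sub_mul, div_mul_cancel₀ _ hD.ne']
        have h4 : ε * (U y / Ψ - 1 / Ψ) * Ψ ^ (1 + r) = c * (γ * (U y - 1)) := by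
          rw [mul_right_comm, hεΨ]; field_simp
        rw [h4]
        nlinarith)
      (by positivity) (by gcongr; exact h.one_le y) (by gcongr)
      (by
        rw [hv, scaledSqDist, Real.div_rpow hU0.le hΨ0.le, ← mul_div_assoc]
        exact div_le_div_of_nonneg_right (h.mul_norm_sq_le hr hxs y) hD.le)
      (by positivity)
      (by
        rw [div_le_div_iff₀ hD ha, hεΨ]
        have h3 : σ ^ 2 * d * a ≤ Ψ := by
          have : 0 ≤ a * d := by positivity
          nlinarith
        calc γ * σ ^ 2 * d * c * a = γ * c * (σ ^ 2 * d * a) := by ring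
          _ ≤ γ * c * Ψ := by gcongr)
    calc _ ≤ ENNReal.ofReal _ + ENNReal.ofReal ε * ENNReal.ofReal (v y ^ q) :=
          add_le_add_left h1 _
      _ ≤ _ := by
          have := hv0 y
          rw [← ENNReal.ofReal_mul hε0.le, ← ENNReal.ofReal_mul hε0.le,
            ← ENNReal.ofReal_add (by positivity) (by positivity),
            ← ENNReal.ofReal_add (by positivity) (by positivity)]
          exact ENNReal.ofReal_le_ofReal h2
  rw [lintegral_chain_succ (g := fun p => ENNReal.ofReal (v p ^ (q + 1))) h.measurable_gradient n x
    (by fun_prop), ← lintegral_const_mul _ (by fun_prop), ← lintegral_add_right _ (by fun_prop)]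
  calc _ ≤ ∫⁻ z, (ENNReal.ofReal (v (chain U σ γ n x z) ^ (q + 1))
          + ENNReal.ofReal ε * ENNReal.ofReal C') ∂noiseLaw d :=
        lintegral_mono fun z => key _
    _ = _ := by
        rw [lintegral_add_right _ measurable_const, lintegral_const, measure_univ, mul_one]

/-- Along the chain started at the minimizer, the time averages of all the moments of the scaled
squared distance to the minimizer are bounded, uniformly in the data. -/
lemma exists_sum_lintegral_scaledSqDist_le (q : ℕ) {a : ℝ} (ha : 0 < a) (ha1 : a ≤ 1) :
    ∃ C : ℝ, 0 < C ∧ ∀ (d : ℕ) (r L c σ γ Ψ : ℝ) (U : Rd d → ℝ) (xs : Rd d), 1 ≤ d →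
      HypH1 r L c U → U xs = 1 → 0 ≤ r → r < 1 → 0 < γ → γ * L ≤ 1 →
      a * (d * (1 + σ ^ 2)) ≤ Ψ → ∀ n : ℕ,
      ∑ k ∈ Finset.range n,
          ∫⁻ z, ENNReal.ofReal (scaledSqDist r c Ψ xs (chain U σ γ k xs z) ^ q) ∂noiseLaw d
        ≤ n * ENNReal.ofReal C := by
  obtain ⟨C, hC, hstep⟩ := exists_lintegral_scaledSqDist_succ_le q ha ha1
  refine ⟨C, hC, fun d r L c σ γ Ψ U xs hd h hxs hr hr1 hγ hγL hΨ n => ?_⟩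
  have hΨ0 : 0 < Ψ := ha.trans_le (scale_le_of_mul_le hd ha hΨ)
  have hc := h.c_pos
  have hε0 : 0 < γ * c * Ψ ^ (-r) := by
    have := Real.rpow_pos_of_pos hΨ0 (-r)
    positivity
  set ε := ENNReal.ofReal (γ * c * Ψ ^ (-r)) with hε
  have key : ∀ n : ℕ,
      ∫⁻ z, ENNReal.ofReal (scaledSqDist r c Ψ xs (chain U σ γ n xs z) ^ (q + 1)) ∂noiseLaw d
      + ε * ∑ k ∈ Finset.range n,
          ∫⁻ z, ENNReal.ofReal (scaledSqDist r c Ψ xs (chain U σ γ k xs z) ^ q) ∂noiseLaw d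
      ≤ ε * (n * ENNReal.ofReal C) := by
    intro n
    induction n with
    | zero => simp [scaledSqDist]
    | succ n ih =>
      have h1 := hstep d r L c σ γ Ψ U xs xs hd h hxs hr hr1 hγ hγL hΨ n
      rw [Finset.sum_range_succ, mul_add]
      calc _ = (∫⁻ z, ENNReal.ofReal
              (scaledSqDist r c Ψ xs (chain U σ γ (n + 1) xs z) ^ (q + 1)) ∂noiseLaw d
            + ε * ∫⁻ z, ENNReal.ofReal
              (scaledSqDist r c Ψ xs (chain U σ γ n xs z) ^ q) ∂noiseLaw d)
            + ε * ∑ k ∈ Finset.range n, ∫⁻ z, ENNReal.ofReal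
              (scaledSqDist r c Ψ xs (chain U σ γ k xs z) ^ q) ∂noiseLaw d := by ring
        _ ≤ _ := add_le_add_left h1 _
        _ = (∫⁻ z, ENNReal.ofReal
              (scaledSqDist r c Ψ xs (chain U σ γ n xs z) ^ (q + 1)) ∂noiseLaw d
            + ε * ∑ k ∈ Finset.range n, ∫⁻ z, ENNReal.ofReal
              (scaledSqDist r c Ψ xs (chain U σ γ k xs z) ^ q) ∂noiseLaw d)
            + ε * ENNReal.ofReal C := by ring
        _ ≤ ε * (n * ENNReal.ofReal C) + ε * ENNReal.ofReal C := add_le_add_left ih _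
        _ = _ := by push_cast; ring
  exact (ENNReal.mul_le_mul_iff_right (ENNReal.ofReal_pos.2 hε0).ne' ENNReal.ofReal_ne_top).1
    (le_add_self.trans (key n))

/-! ### Synchronous coupling -/

/-- Jensen's inequality for the convex function `t ↦ t ^ (-r)` and the uniform average. -/
lemma card_mul_rpow_neg_le_sum {r : ℝ} (hr : 0 ≤ r) {n : ℕ} (hn : 0 < n) {W : ℕ → ℝ}
    (hW : ∀ k, 0 < W k) :
    n * ((∑ k ∈ Finset.range n, W k) / n) ^ (-r) ≤ ∑ k ∈ Finset.range n, W k ^ (-r) := by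
  have hn' : (0 : ℝ) < n := by exact_mod_cast hn
  set ω := (∑ k ∈ Finset.range n, W k) / n with hω
  have hω0 : 0 < ω :=
    div_pos (Finset.sum_pos (fun k _ => hW k) (Finset.nonempty_range_iff.2 hn.ne')) hn'
  have hωr : 0 < ω ^ (-r) := Real.rpow_pos_of_pos hω0 _
  -- The tangent line at the average.
  have key : ∀ k, ω ^ (-r) * (1 - r * (W k / ω - 1)) ≤ W k ^ (-r) := by
    intro k
    have hs : 0 < W k / ω := div_pos (hW k) hω0
    have h1 : 1 - r * (W k / ω - 1) ≤ (W k / ω) ^ (-r) := by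
      rw [Real.rpow_def_of_pos hs]
      have h2 := Real.add_one_le_exp (Real.log (W k / ω) * -r)
      have h3 := mul_le_mul_of_nonneg_left (Real.log_le_sub_one_of_pos hs) hr
      linarith
    have h2 : W k ^ (-r) = ω ^ (-r) * (W k / ω) ^ (-r) := by
      rw [← Real.mul_rpow hω0.le hs.le, mul_div_cancel₀ _ hω0.ne']
    rw [h2]
    gcongr
  refine le_trans (le_of_eq ?_) (Finset.sum_le_sum fun k _ => key k)
  have hsum : ∑ k ∈ Finset.range n, W k = n * ω := by rw [hω]; field_simp
  rw [← Finset.mul_sum, Finset.sum_sub_distrib, ← Finset.mul_sum, Finset.sum_sub_distrib,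
    ← Finset.sum_div, hsum]
  simp only [Finset.sum_const, Finset.card_range, nsmul_eq_mul, mul_one]
  field_simp
  ring

lemma exp_neg_mul_rpow_neg_le (m : ℕ) {r T s : ℝ} (hr : 0 ≤ r) (hr1 : r < 1) (hT : 0 < T)
    (hs : 0 < s) :
    Real.exp (-(T / 2 * s ^ (-r))) ≤ m.factorial * 2 ^ m / T ^ m * (1 + s) ^ m := by
  have hsr : s ^ r ≤ 1 + s := by
    rcases le_total s 1 with h | h
    · exact (Real.rpow_le_one hs.le h hr).trans (by linarith)
    · calc s ^ r ≤ s ^ (1 : ℝ) := Real.rpow_le_rpow_of_exponent_le h hr1.le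
        _ ≤ 1 + s := by rw [Real.rpow_one]; linarith
  have hsr0 : 0 < s ^ r := Real.rpow_pos_of_pos hs r
  have hx : 0 < T / 2 * s ^ (-r) := mul_pos (by positivity) (Real.rpow_pos_of_pos hs _)
  have h1 := Real.pow_div_factorial_le_exp _ hx.le m
  have hf : (0 : ℝ) < m.factorial := by exact_mod_cast m.factorial_pos
  rw [Real.exp_neg]
  calc (Real.exp (T / 2 * s ^ (-r)))⁻¹
      ≤ ((T / 2 * s ^ (-r)) ^ m / m.factorial)⁻¹ := by gcongr
    _ = m.factorial * 2 ^ m / T ^ m * (s ^ r) ^ m := by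
        rw [Real.rpow_neg hs.le, mul_pow, div_pow, inv_pow]
        field_simp
    _ ≤ _ := by gcongr

section Coupling

variable {d : ℕ} {r L c : ℝ} {U : Rd d → ℝ}

lemma norm_chain_sub_le_exp (h : HypH1 r L c U) (hr : 0 ≤ r) {γ : ℝ} (σ : ℝ) (hγ : 0 ≤ γ)
    (hγL : γ * L ≤ 1) (x y : Rd d) (z : ℕ → Rd d) (n : ℕ) :
    ‖chain U σ γ n x z - chain U σ γ n y z‖ ≤
      Real.exp (-(γ * c / 2 * ∑ k ∈ Finset.range n,
        (U (chain U σ γ k x z) + U (chain U σ γ k y z)) ^ (-r))) * ‖x - y‖ := by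
  induction n with
  | zero => simp
  | succ n ih =>
    set X := chain U σ γ n x z
    set Y := chain U σ γ n y z
    have h1 := h.norm_gradient_step_sub_le hr hγ hγL (W := U X + U Y) (x := X) (y := Y)
      (by linarith [h.pos Y]) (by linarith [h.pos X])
    rw [chain_succ, chain_succ, add_sub_add_right_eq_sub]
    refine h1.trans ((mul_le_mul_of_nonneg_left ih (Real.exp_pos _).le).trans (le_of_eq ?_))
    rw [← mul_assoc, ← Real.exp_add, Finset.sum_range_succ]
    congr 2
    ring

lemma norm_chain_sub_le (h : HypH1 r L c U) (hr : 0 ≤ r) {γ : ℝ} (σ : ℝ) (hγ : 0 ≤ γ)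
    (hγL : γ * L ≤ 1) (x y : Rd d) (z : ℕ → Rd d) (n : ℕ) :
    ‖chain U σ γ n x z - chain U σ γ n y z‖ ≤ ‖x - y‖ := by
  refine (norm_chain_sub_le_exp h hr σ hγ hγL x y z n).trans
    (mul_le_of_le_one_left (norm_nonneg _) ?_)
  rw [Real.exp_le_one_iff, neg_nonpos]
  have hc := h.c_pos
  refine mul_nonneg (by positivity) (Finset.sum_nonneg fun k _ => Real.rpow_nonneg ?_ _)
  linarith [h.pos (chain U σ γ k x z), h.pos (chain U σ γ k y z)]

/-- Along a path of the noise, the contraction is governed by the time averages of `U` along the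
two chains. -/
lemma norm_chain_sub_le_excess (h : HypH1 r L c U) (hr : 0 ≤ r) (hr1 : r < 1) {γ Ψ : ℝ} (σ : ℝ)
    (hγ : 0 < γ) (hγL : γ * L ≤ 1) (hΨ : 0 < Ψ) (m : ℕ) (x y : Rd d) (z : ℕ → Rd d) {n : ℕ}
    (hn : 0 < n) :
    ‖chain U σ γ n x z - chain U σ γ n y z‖ ≤
      m.factorial * 2 ^ m / (c * (n * γ) / Ψ ^ r) ^ m
        * (1 + (2 / Ψ + excess U σ γ n x z / (n * γ * Ψ)
          + excess U σ γ n y z / (n * γ * Ψ))) ^ m * ‖x - y‖ := by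
  have hn' : (0 : ℝ) < n := by exact_mod_cast hn
  have hc := h.c_pos
  have hΨr : 0 < Ψ ^ r := Real.rpow_pos_of_pos hΨ r
  set W : ℕ → ℝ := fun k => U (chain U σ γ k x z) + U (chain U σ γ k y z) with hWdef
  have hW : ∀ k, 0 < W k := fun k => add_pos (h.pos _) (h.pos _)
  set ω := (∑ k ∈ Finset.range n, W k) / n with hω
  have hω0 : 0 < ω :=
    div_pos (Finset.sum_pos (fun k _ => hW k) (Finset.nonempty_range_iff.2 hn.ne')) hn'
  have hωe : ω / Ψ = 2 / Ψ + excess U σ γ n x z / (n * γ * Ψ)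
      + excess U σ γ n y z / (n * γ * Ψ) := by
    have : ∑ k ∈ Finset.range n, W k = 2 * n
        + ∑ k ∈ Finset.range n, (U (chain U σ γ k x z) - 1)
        + ∑ k ∈ Finset.range n, (U (chain U σ γ k y z) - 1) := by
      simp only [W, Finset.sum_add_distrib, Finset.sum_sub_distrib, Finset.sum_const,
        Finset.card_range, nsmul_eq_mul]
      ring
    rw [hω, this, excess, excess]
    field_simp
  have h1 := norm_chain_sub_le_exp h hr σ hγ.le hγL x y z n
  have h2 := card_mul_rpow_neg_le_sum hr hn hW
  rw [← hω] at h2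
  have h3 := exp_neg_mul_rpow_neg_le m hr hr1 (T := c * (n * γ) / Ψ ^ r) (by positivity)
    (div_pos hω0 hΨ)
  rw [← hωe]
  refine h1.trans (mul_le_mul_of_nonneg_right (le_trans (Real.exp_le_exp.2 ?_) h3)
    (norm_nonneg _))
  rw [neg_le_neg_iff]
  have h4 : c * (n * γ) / Ψ ^ r / 2 * (ω / Ψ) ^ (-r) = γ * c / 2 * (n * ω ^ (-r)) := by
    rw [Real.div_rpow hω0.le hΨ.le, Real.rpow_neg hΨ.le]
    field_simp
  rw [h4]
  gcongr

end Coupling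

/-- The two chains approach each other in `L^1` faster than any power of the time `n γ`, which is
measured in the unit `Ψ ^ r / c`. -/
lemma exists_lintegral_norm_chain_sub_le (m : ℕ) {a : ℝ} (ha : 0 < a) (ha1 : a ≤ 1) :
    ∃ K : ℝ, 0 < K ∧ ∀ (d : ℕ) (r L c σ γ Ψ : ℝ) (U : Rd d → ℝ) (xs x y : Rd d), 1 ≤ d →
      HypH1 r L c U → U xs = 1 → 0 ≤ r → r < 1 → 0 < γ → γ * L ≤ 1 →
      a * (d * (1 + σ ^ 2)) ≤ Ψ → ∀ n : ℕ, 0 < n → 1 ≤ c * (n * γ) / Ψ ^ r →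
      ∫⁻ z, ENNReal.ofReal ‖chain U σ γ n x z - chain U σ γ n y z‖ ∂noiseLaw d
        ≤ ENNReal.ofReal (K / (c * (n * γ) / Ψ ^ r) ^ m * ‖x - y‖
          * (1 + scaledSqDist r c Ψ xs x + scaledSqDist r c Ψ xs y) ^ m) := by
  obtain ⟨C, hC, hmom⟩ := exists_lintegral_sq_add_excess_le m
  refine ⟨m.factorial * 2 ^ m * (3 ^ m * ((1 + 2 / a) ^ m + C * (1 / a) ^ m + C * (1 / a) ^ m)),
    by positivity, fun d r L c σ γ Ψ U xs x y hd h hxs hr hr1 hγ hγL hΨ n hn hT => ?_⟩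
  have haΨ : a ≤ Ψ := scale_le_of_mul_le hd ha hΨ
  have hΨ0 : 0 < Ψ := ha.trans_le haΨ
  have hn' : (0 : ℝ) < n := by exact_mod_cast hn
  have hc := h.c_pos
  have hΨr : 0 < Ψ ^ r := Real.rpow_pos_of_pos hΨ0 r
  set T := c * (n * γ) / Ψ ^ r with hTdef
  have hT0 : 0 < T := by positivity
  have hv0 : ∀ y, 0 ≤ scaledSqDist r c Ψ xs y := scaledSqDist_nonneg hc.le hΨ0.le xs
  set B := 1 + scaledSqDist r c Ψ xs x + scaledSqDist r c Ψ xs y with hB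
  have hB1 : 1 ≤ B := by rw [hB]; linarith [hv0 x, hv0 y]
  -- The moment of the time average of `U` along one chain.
  have hone : ∀ p : Rd d, scaledSqDist r c Ψ xs p ≤ B - 1 →
      ∫⁻ z, ENNReal.ofReal ((excess U σ γ n p z / (n * γ * Ψ)) ^ m) ∂noiseLaw d
        ≤ ENNReal.ofReal (C * (1 / a) ^ m * B ^ m) := by
    intro p hp
    have e1 : ∀ z, ENNReal.ofReal ((excess U σ γ n p z / (n * γ * Ψ)) ^ m)
        ≤ ENNReal.ofReal (1 / (n * γ * Ψ) ^ m) * ENNReal.ofReal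
          ((‖chain U σ γ n p z - xs‖ ^ 2 + excess U σ γ n p z) ^ m) := by
      intro z
      rw [← ENNReal.ofReal_mul (by positivity), div_pow, div_mul_eq_mul_div, one_mul]
      have := excess_nonneg (σ := σ) h hγ.le n p z
      gcongr
      linarith [sq_nonneg ‖chain U σ γ n p z - xs‖]
    refine (lintegral_mono e1).trans ?_
    rw [lintegral_const_mul' _ _ ENNReal.ofReal_ne_top]
    refine (mul_le_mul_right (hmom d r L c σ γ U xs p h hxs hγ.le hγL n) _).trans ?_
    rw [← ENNReal.ofReal_mul (by positivity)]
    refine ENNReal.ofReal_le_ofReal ?_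
    have e2 : 1 / (n * γ * Ψ) ^ m * (C * (‖p - xs‖ ^ 2 + n * (γ * σ ^ 2 * d)) ^ m)
        = C * (scaledSqDist r c Ψ xs p / T + σ ^ 2 * d / Ψ) ^ m := by
      have : scaledSqDist r c Ψ xs p / T + σ ^ 2 * d / Ψ
          = (‖p - xs‖ ^ 2 + n * (γ * σ ^ 2 * d)) / (n * γ * Ψ) := by
        rw [scaledSqDist, hTdef, Real.rpow_add hΨ0, Real.rpow_one]
        field_simp
      rw [this, div_pow]; ring
    rw [e2, mul_assoc, ← mul_pow]
    have e3 : scaledSqDist r c Ψ xs p / T ≤ scaledSqDist r c Ψ xs p :=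
      div_le_self (hv0 p) hT
    have e4 : σ ^ 2 * d / Ψ ≤ 1 / a := by
      rw [div_le_div_iff₀ hΨ0 ha, one_mul]
      nlinarith [mul_nonneg ha.le (Nat.cast_nonneg (α := ℝ) d)]
    have e5 : scaledSqDist r c Ψ xs p ≤ 1 / a * scaledSqDist r c Ψ xs p :=
      le_mul_of_one_le_left (hv0 p) (by rw [le_div_iff₀ ha]; linarith)
    have e6 : 1 / a * scaledSqDist r c Ψ xs p ≤ 1 / a * (B - 1) := by gcongr
    have e7 := hv0 p
    gcongr
    linarith
  set α : (ℕ → Rd d) → ℝ := fun z => excess U σ γ n x z / (n * γ * Ψ) with hα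
  set β : (ℕ → Rd d) → ℝ := fun z => excess U σ γ n y z / (n * γ * Ψ) with hβ
  have hα0 : ∀ z, 0 ≤ α z := fun z => div_nonneg (excess_nonneg h hγ.le n x z) (by positivity)
  have hβ0 : ∀ z, 0 ≤ β z := fun z => div_nonneg (excess_nonneg h hγ.le n y z) (by positivity)
  have hαm : Measurable α := (measurable_excess h n x).div_const _
  have hβm : Measurable β := (measurable_excess h n y).div_const _
  set Q := m.factorial * 2 ^ m / T ^ m * ‖x - y‖ * 3 ^ m with hQ
  have hQ0 : 0 ≤ Q := by positivity
  have hpt : ∀ z, ENNReal.ofReal ‖chain U σ γ n x z - chain U σ γ n y z‖ ≤ ENNReal.ofReal Q *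
      (ENNReal.ofReal ((1 + 2 / a) ^ m) + ENNReal.ofReal (α z ^ m)
        + ENNReal.ofReal (β z ^ m)) := by
    intro z
    have h1 := norm_chain_sub_le_excess h hr hr1 σ hγ hγL hΨ0 m x y z hn
    have h2 := hα0 z
    have h3 := hβ0 z
    rw [← ENNReal.ofReal_add (by positivity) (by positivity),
      ← ENNReal.ofReal_add (by positivity) (by positivity), ← ENNReal.ofReal_mul hQ0]
    refine ENNReal.ofReal_le_ofReal (h1.trans ?_)
    have h4 : (1 + (2 / Ψ + α z + β z)) ^ m
        ≤ 3 ^ m * ((1 + 2 / a) ^ m + α z ^ m + β z ^ m) := by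
      have h5 : 2 / Ψ ≤ 2 / a := by gcongr
      set M := max (1 + 2 / a) (max (α z) (β z)) with hM
      have hM1 : 1 + 2 / a ≤ M := le_max_left _ _
      have hM2 : α z ≤ M := (le_max_left _ _).trans (le_max_right _ _)
      have hM3 : β z ≤ M := (le_max_right _ _).trans (le_max_right _ _)
      have h6 : M ^ m ≤ (1 + 2 / a) ^ m + α z ^ m + β z ^ m := by
        have p1 : 0 ≤ (1 + 2 / a) ^ m := by positivity
        have p2 : 0 ≤ α z ^ m := by positivity
        have p3 : 0 ≤ β z ^ m := by positivity
        rcases max_choice (1 + 2 / a) (max (α z) (β z)) with h7 | h7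
        · rw [hM, h7]; linarith
        · rcases max_choice (α z) (β z) with h8 | h8
          · rw [hM, h7, h8]; linarith
          · rw [hM, h7, h8]; linarith
      calc (1 + (2 / Ψ + α z + β z)) ^ m ≤ (3 * M) ^ m := by gcongr; linarith
        _ = 3 ^ m * M ^ m := mul_pow _ _ _
        _ ≤ _ := by gcongr
    calc _ ≤ m.factorial * 2 ^ m / T ^ m
          * (3 ^ m * ((1 + 2 / a) ^ m + α z ^ m + β z ^ m)) * ‖x - y‖ := by gcongr
      _ = _ := by rw [hQ]; ring
  refine (lintegral_mono hpt).trans ?_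
  rw [lintegral_const_mul' _ _ ENNReal.ofReal_ne_top,
    lintegral_add_right _ (hβm.pow_const m).ennreal_ofReal,
    lintegral_add_right _ (hαm.pow_const m).ennreal_ofReal, lintegral_const, measure_univ, mul_one]
  refine (mul_le_mul_right (add_le_add (add_le_add le_rfl
    (hone x (by rw [hB]; linarith [hv0 y]))) (hone y (by rw [hB]; linarith [hv0 x]))) _).trans ?_
  rw [← ENNReal.ofReal_add (by positivity) (by positivity),
      ← ENNReal.ofReal_add (by positivity) (by positivity), ← ENNReal.ofReal_mul hQ0]
  refine ENNReal.ofReal_le_ofReal ?_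
  have hBm : (1 : ℝ) ≤ B ^ m := one_le_pow₀ hB1
  have h8 : (1 + 2 / a) ^ m ≤ (1 + 2 / a) ^ m * B ^ m :=
    le_mul_of_one_le_right (by positivity) hBm
  calc Q * ((1 + 2 / a) ^ m + C * (1 / a) ^ m * B ^ m + C * (1 / a) ^ m * B ^ m)
      ≤ Q * ((1 + 2 / a) ^ m * B ^ m + C * (1 / a) ^ m * B ^ m + C * (1 / a) ^ m * B ^ m) := by
        gcongr
    _ = _ := by rw [hQ]; ring

/-! ### Comparison with the rate -/

/-- The rate in terms of the time `n γ` measured in the unit `Ψ ^ r / c`. -/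
lemma rate_eq {r κ γ c Ψ : ℝ} (hγ : 0 < γ) (hc : 0 < c) (hΨ : 0 < Ψ) {φ : ℝ≥0 → ℝ}
    (hφ : ∀ t, 0 < φ t) {n : ℕ} (hn : 0 < n) :
    rate r κ γ c Ψ φ n = c ^ (-(1 / 2 : ℝ)) * Ψ ^ ((1 + r) / 2) *
      (Real.exp (-φ n) + (φ n / (c * (n * γ) / Ψ ^ r)) ^ (κ / 2)) := by
  have hn' : (0 : ℝ) < n := by exact_mod_cast hn
  have hp := hφ n
  have hΨr : 0 < Ψ ^ r := Real.rpow_pos_of_pos hΨ r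
  have e1 : φ n / (c * (n * γ) / Ψ ^ r) = φ n / (n * γ) * (Ψ ^ r * c⁻¹) := by field_simp
  rw [rate, e1, Real.mul_rpow (by positivity) (by positivity),
    Real.mul_rpow hΨr.le (by positivity), ← Real.rpow_mul hΨ.le, Real.inv_rpow hc.le,
    ← Real.rpow_neg hc.le]
  have e2 : c ^ (-((κ + 1) / 2)) = c ^ (-(1 / 2 : ℝ)) * c ^ (-(κ / 2)) := by
    rw [← Real.rpow_add hc]; congr 1; ring
  have e3 : Ψ ^ ((1 + r * (1 + κ)) / 2) = Ψ ^ ((1 + r) / 2) * Ψ ^ (r * (κ / 2)) := by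
    rw [← Real.rpow_add hΨ]; congr 1; ring
  rw [e2, e3]
  ring

/-- Whatever the value `p` of the auxiliary function, the rate is not smaller than the power
`T ^ (-κ / 2)` for `T ≥ 1`, nor than a constant for `T ≤ 1`. -/
lemma le_exp_one_mul_exp_neg_add_rpow {κ p T s : ℝ} (hκ : 0 < κ) (hp : 0 < p) (hT : 0 < T)
    (hs1 : s ≤ 1) (hs : s ≤ (1 / T) ^ (κ / 2)) :
    s ≤ Real.exp 1 * (Real.exp (-p) + (p / T) ^ (κ / 2)) := by
  have h0 : 0 ≤ (p / T) ^ (κ / 2) := by positivity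
  have he : 1 ≤ Real.exp 1 := Real.one_le_exp zero_le_one
  rcases le_total p 1 with h | h
  · have h1 : Real.exp 1 * Real.exp (-1) = 1 := by rw [← Real.exp_add]; simp
    have h2 : Real.exp (-1) ≤ Real.exp (-p) := Real.exp_le_exp.2 (by linarith)
    calc s ≤ Real.exp 1 * Real.exp (-1) := by rw [h1]; exact hs1
      _ ≤ _ := by gcongr; linarith
  · have h1 : (1 / T) ^ (κ / 2) ≤ (p / T) ^ (κ / 2) := by gcongr
    calc s ≤ 1 * (p / T) ^ (κ / 2) := by linarith
      _ ≤ _ := by gcongr; linarith [Real.exp_pos (-p)]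

lemma norm_sub_le_scaledSqDist {d : ℕ} {r c Ψ : ℝ} (hc : 0 < c) (hΨ : 0 < Ψ) (xs x y : Rd d) :
    ‖x - y‖ ≤ c ^ (-(1 / 2 : ℝ)) * Ψ ^ ((1 + r) / 2) *
      (1 + scaledSqDist r c Ψ xs x + scaledSqDist r c Ψ xs y) := by
  set g := c ^ (-(1 / 2 : ℝ)) * Ψ ^ ((1 + r) / 2) with hg
  have hg0 : 0 < g := mul_pos (Real.rpow_pos_of_pos hc _) (Real.rpow_pos_of_pos hΨ _)
  have hg2 : g ^ 2 = Ψ ^ (1 + r) / c := by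
    rw [hg, mul_pow, ← Real.rpow_natCast, ← Real.rpow_natCast, ← Real.rpow_mul hc.le,
      ← Real.rpow_mul hΨ.le]
    norm_num
    rw [Real.rpow_neg_one]; ring
  have hone : ∀ p : Rd d, ‖p - xs‖ ≤ g * ((1 + scaledSqDist r c Ψ xs p) / 2) := by
    intro p
    have hv := scaledSqDist_nonneg (r := r) hc.le hΨ.le xs p
    have h1 : ‖p - xs‖ ^ 2 = g ^ 2 * scaledSqDist r c Ψ xs p := by
      have : 0 < Ψ ^ (1 + r) := Real.rpow_pos_of_pos hΨ _
      rw [hg2, scaledSqDist]; field_simp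
    refine (abs_le_of_sq_le_sq' ?_ (by positivity)).2
    rw [h1, mul_pow g]
    refine mul_le_mul_of_nonneg_left ?_ (sq_nonneg g)
    nlinarith [sq_nonneg (1 - scaledSqDist r c Ψ xs p)]
  have h1 : ‖x - y‖ ≤ ‖x - xs‖ + ‖y - xs‖ := by
    rw [norm_sub_rev y xs]; exact norm_sub_le_norm_sub_add_norm_sub x xs y
  have hx := scaledSqDist_nonneg (r := r) hc.le hΨ.le xs x
  have hy := scaledSqDist_nonneg (r := r) hc.le hΨ.le xs y
  calc ‖x - y‖ ≤ g * ((1 + scaledSqDist r c Ψ xs x) / 2)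
          + g * ((1 + scaledSqDist r c Ψ xs y) / 2) :=
        h1.trans (add_le_add (hone x) (hone y))
    _ = g * ((2 + scaledSqDist r c Ψ xs x + scaledSqDist r c Ψ xs y) / 2) := by ring
    _ ≤ _ := by gcongr; linarith

/-- Two chains driven by the same noise approach each other at the announced rate, up to a power of
the scaled squared distances of their starting points to the minimizer. -/
lemma exists_lintegral_norm_chain_sub_le_rate {κ : ℝ} (hκ : 0 < κ) {a : ℝ} (ha : 0 < a)
    (ha1 : a ≤ 1) :
    ∃ K : ℝ, 0 < K ∧ ∀ (d : ℕ) (r L c σ γ Ψ : ℝ) (U : Rd d → ℝ) (xs x y : Rd d), 1 ≤ d →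
      HypH1 r L c U → U xs = 1 → 0 ≤ r → r < 1 → 0 < γ → γ * L ≤ 1 →
      a * (d * (1 + σ ^ 2)) ≤ Ψ → ∀ φ : ℝ≥0 → ℝ, (∀ t, 0 < φ t) → ∀ n : ℕ, 0 < n →
      ∫⁻ z, ENNReal.ofReal ‖chain U σ γ n x z - chain U σ γ n y z‖ ∂noiseLaw d
        ≤ ENNReal.ofReal (K * rate r κ γ c Ψ φ n
          * (1 + scaledSqDist r c Ψ xs x + scaledSqDist r c Ψ xs y) ^ (⌈κ / 2⌉₊ + 1)) := by
  set m := ⌈κ / 2⌉₊ with hm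
  obtain ⟨K, hK, hdecay⟩ := exists_lintegral_norm_chain_sub_le m ha ha1
  refine ⟨(K + 1) * Real.exp 1, by positivity,
    fun d r L c σ γ Ψ U xs x y hd h hxs hr hr1 hγ hγL hΨ φ hφ n hn => ?_⟩
  have hΨ0 : 0 < Ψ := ha.trans_le (scale_le_of_mul_le hd ha hΨ)
  have hn' : (0 : ℝ) < n := by exact_mod_cast hn
  have hc := h.c_pos
  have hΨr : 0 < Ψ ^ r := Real.rpow_pos_of_pos hΨ0 r
  set T := c * (n * γ) / Ψ ^ r with hTdef
  have hT0 : 0 < T := by positivity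
  set B := 1 + scaledSqDist r c Ψ xs x + scaledSqDist r c Ψ xs y with hB
  have hB1 : 1 ≤ B := by
    rw [hB]
    linarith [scaledSqDist_nonneg (r := r) hc.le hΨ0.le xs x,
      scaledSqDist_nonneg (r := r) hc.le hΨ0.le xs y]
  set g := c ^ (-(1 / 2 : ℝ)) * Ψ ^ ((1 + r) / 2) with hg
  have hg0 : 0 < g := mul_pos (Real.rpow_pos_of_pos hc _) (Real.rpow_pos_of_pos hΨ0 _)
  have hxy : ‖x - y‖ ≤ g * B := norm_sub_le_scaledSqDist hc hΨ0 xs x y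
  have hrate : rate r κ γ c Ψ φ n
      = g * (Real.exp (-φ n) + (φ n / T) ^ (κ / 2)) := rate_eq hγ hc hΨ0 hφ hn
  set ρ := Real.exp (-φ n) + (φ n / T) ^ (κ / 2) with hρ
  have hρ0 : 0 ≤ ρ := by have := hφ n; positivity
  rw [hrate]
  rcases le_total 1 T with hT | hT
  · refine (hdecay d r L c σ γ Ψ U xs x y hd h hxs hr hr1 hγ hγL hΨ n hn hT).trans
      (ENNReal.ofReal_le_ofReal ?_)
    have h1 : (1 / T) ^ m ≤ Real.exp 1 * ρ := by
      have hT1 : 1 / T ≤ 1 := (div_le_one hT0).2 hT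
      refine le_exp_one_mul_exp_neg_add_rpow hκ (hφ n) hT0 (pow_le_one₀ (by positivity) hT1) ?_
      rw [← Real.rpow_natCast]
      exact Real.rpow_le_rpow_of_exponent_ge (by positivity) hT1 (Nat.le_ceil _)
    calc K / T ^ m * ‖x - y‖ * B ^ m = K * (1 / T) ^ m * ‖x - y‖ * B ^ m := by
          rw [one_div_pow]; ring
      _ ≤ (K + 1) * (Real.exp 1 * ρ) * (g * B) * B ^ m := by gcongr; linarith
      _ = _ := by ring
  · have h1 : 1 ≤ Real.exp 1 * ρ :=
      le_exp_one_mul_exp_neg_add_rpow hκ (hφ n) hT0 le_rfl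
        (Real.one_le_rpow ((one_le_div hT0).2 hT) (by positivity))
    calc _ ≤ ∫⁻ _, ENNReal.ofReal ‖x - y‖ ∂noiseLaw d :=
          lintegral_mono fun z => ENNReal.ofReal_le_ofReal
            (norm_chain_sub_le h hr σ hγ.le hγL x y z n)
      _ = ENNReal.ofReal ‖x - y‖ := by simp
      _ ≤ _ := by
          refine ENNReal.ofReal_le_ofReal ?_
          calc ‖x - y‖ ≤ g * B := hxy
            _ ≤ g * B ^ (m + 1) := by gcongr; exact le_self_pow₀ hB1 (Nat.succ_ne_zero m)
            _ ≤ g * B ^ (m + 1) * ((K + 1) * (Real.exp 1 * ρ)) := by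
                refine le_mul_of_one_le_right (by positivity) ?_
                nlinarith
            _ = _ := by ring

/-! ### The transition of the chain on laws -/

/-- The law of the Euler scheme one step after it has the law `μ`. -/
def eulerLaw {d : ℕ} (U : Rd d → ℝ) (σ γ : ℝ) (μ : Measure (Rd d)) : Measure (Rd d) :=
  (μ.prod (stdGaussian (Rd d))).map
    (fun p : Rd d × Rd d => p.1 - γ • ∇ U p.1 + (σ * √γ) • p.2)

/-- The law at time `n` of the Euler scheme started at `x`. -/
def chainLaw {d : ℕ} (U : Rd d → ℝ) (σ γ : ℝ) (x : Rd d) (n : ℕ) : Measure (Rd d) :=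
  (noiseLaw d).map (chain U σ γ n x)

/-- The average of the laws of the Euler scheme at the times `0, …, n`. -/
def cesaroLaw {d : ℕ} (U : Rd d → ℝ) (σ γ : ℝ) (x : Rd d) (n : ℕ) : Measure (Rd d) :=
  ((n + 1 : ℕ) : ENNReal)⁻¹ • ∑ k ∈ Finset.range (n + 1), chainLaw U σ γ x k

section Laws

variable {d : ℕ} {U : Rd d → ℝ} {σ γ : ℝ}

lemma lintegral_eulerLaw (hU : Measurable (∇ U)) (μ : Measure (Rd d))
    {g : Rd d → ENNReal} (hg : Measurable g) :
    ∫⁻ y, g y ∂eulerLaw U σ γ μ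
      = ∫⁻ x, ∫⁻ y, g (x - γ • ∇ U x + (σ * √γ) • y) ∂stdGaussian (Rd d) ∂μ := by
  rw [eulerLaw, lintegral_map hg (measurable_eulerStep hU)]
  exact lintegral_prod _ (hg.comp (measurable_eulerStep hU)).aemeasurable

lemma measurable_transition (hU : Measurable (∇ U)) {g : Rd d → ENNReal} (hg : Measurable g) :
    Measurable fun x => ∫⁻ y, g (x - γ • ∇ U x + (σ * √γ) • y) ∂stdGaussian (Rd d) :=
  (hg.comp (measurable_eulerStep hU)).lintegral_prod_right'

lemma lintegral_chainLaw (hU : Measurable (∇ U)) (x : Rd d) (n : ℕ) {g : Rd d → ENNReal}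
    (hg : Measurable g) :
    ∫⁻ y, g y ∂chainLaw U σ γ x n = ∫⁻ z, g (chain U σ γ n x z) ∂noiseLaw d :=
  lintegral_map hg (measurable_chain hU n x)

lemma eulerLaw_chainLaw (hU : Measurable (∇ U)) (x : Rd d) (n : ℕ) :
    eulerLaw U σ γ (chainLaw U σ γ x n) = chainLaw U σ γ x (n + 1) := by
  refine Measure.ext_of_lintegral _ fun g hg => ?_
  rw [lintegral_eulerLaw hU _ hg, lintegral_chainLaw hU x n (measurable_transition hU hg),
    lintegral_chainLaw hU x (n + 1) hg, lintegral_chain_succ hU n x hg]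

lemma lintegral_cesaroLaw (x : Rd d) (n : ℕ) (g : Rd d → ENNReal) :
    ∫⁻ y, g y ∂cesaroLaw U σ γ x n = ((n + 1 : ℕ) : ENNReal)⁻¹ *
      ∑ k ∈ Finset.range (n + 1), ∫⁻ y, g y ∂chainLaw U σ γ x k := by
  rw [cesaroLaw, lintegral_smul_measure, lintegral_finsetSum_measure, smul_eq_mul]

lemma isProbabilityMeasure_chainLaw (hU : Measurable (∇ U)) (x : Rd d) (n : ℕ) :
    IsProbabilityMeasure (chainLaw U σ γ x n) :=
  Measure.isProbabilityMeasure_map (measurable_chain hU n x).aemeasurable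

lemma isProbabilityMeasure_cesaroLaw (hU : Measurable (∇ U)) (x : Rd d) (n : ℕ) :
    IsProbabilityMeasure (cesaroLaw U σ γ x n) := by
  have := fun k => isProbabilityMeasure_chainLaw (σ := σ) (γ := γ) hU x k
  constructor
  rw [← lintegral_one, lintegral_cesaroLaw]
  simp only [lintegral_one, measure_univ, Finset.sum_const, Finset.card_range, nsmul_eq_mul,
    mul_one]
  exact ENNReal.inv_mul_cancel (by simp) (ENNReal.natCast_ne_top _)

lemma isProbabilityMeasure_eulerLaw (hU : Measurable (∇ U)) (μ : Measure (Rd d))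
    [IsProbabilityMeasure μ] : IsProbabilityMeasure (eulerLaw U σ γ μ) :=
  Measure.isProbabilityMeasure_map (measurable_eulerStep hU).aemeasurable

/-- A step of the chain changes an average of its laws by the two boundary terms only. -/
lemma eulerLaw_cesaroLaw_add (hU : Measurable (∇ U)) (x : Rd d) (n : ℕ) :
    eulerLaw U σ γ (cesaroLaw U σ γ x n)
        + ((n + 1 : ℕ) : ENNReal)⁻¹ • chainLaw U σ γ x 0
      = cesaroLaw U σ γ x n + ((n + 1 : ℕ) : ENNReal)⁻¹ • chainLaw U σ γ x (n + 1) := by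
  refine Measure.ext_of_lintegral _ fun g hg => ?_
  rw [lintegral_add_measure, lintegral_add_measure, lintegral_smul_measure, lintegral_smul_measure,
    lintegral_eulerLaw hU _ hg, lintegral_cesaroLaw, lintegral_cesaroLaw, smul_eq_mul, smul_eq_mul,
    ← mul_add, ← mul_add]
  have h1 : ∀ k, ∫⁻ x, ∫⁻ y, g (x - γ • ∇ U x + (σ * √γ) • y) ∂stdGaussian (Rd d)
      ∂chainLaw U σ γ x k = ∫⁻ y, g y ∂chainLaw U σ γ x (k + 1) := fun k => by
    rw [← lintegral_eulerLaw hU _ hg, eulerLaw_chainLaw hU]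
  simp only [h1]
  rw [← Finset.sum_range_succ (fun k => ∫⁻ y, g y ∂chainLaw U σ γ x k) (n + 1),
    Finset.sum_range_succ' _ (n + 1)]

/-- The chain started from an invariant law keeps this law. -/
lemma IsEulerInvariant.map_chain (hU : Measurable (∇ U)) {ν : Measure (Rd d)}
    (hν : IsEulerInvariant U σ γ ν) (n : ℕ) :
    (ν.prod (noiseLaw d)).map (fun p => chain U σ γ n p.1 p.2) = ν := by
  have := hν.isProbabilityMeasure
  have hlaw : ∀ n {g : Rd d → ENNReal}, Measurable g →
      ∫⁻ x, ∫⁻ z, g (chain U σ γ n x z) ∂noiseLaw d ∂ν = ∫⁻ x, g x ∂ν := by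
    intro n
    induction n with
    | zero => intro g hg; simp
    | succ n ih =>
      intro g hg
      simp only [lintegral_chain_succ hU n _ hg]
      rw [ih (measurable_transition hU hg), ← lintegral_eulerLaw hU _ hg, eulerLaw, hν.map_eq]
  refine Measure.ext_of_lintegral _ fun g hg => ?_
  have hm := measurable_chain_uncurry (σ := σ) (γ := γ) hU n
  rw [lintegral_map hg hm, ← hlaw n hg]
  exact lintegral_prod _ (hg.comp hm).aemeasurable

end Laws

/-! ### Existence of an invariant law -/

lemma continuous_eulerLaw {d : ℕ} {U : Rd d → ℝ} {σ γ : ℝ} (hU : Continuous (∇ U)) :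
    ∃ T : ProbabilityMeasure (Rd d) → ProbabilityMeasure (Rd d), Continuous T ∧
      ∀ μ, (T μ : Measure (Rd d)) = eulerLaw U σ γ μ := by
  have hF : Continuous fun p : Rd d × Rd d => p.1 - γ • ∇ U p.1 + (σ * √γ) • p.2 := by
    have h1 : Continuous fun p : Rd d × Rd d => ∇ U p.1 := hU.comp continuous_fst
    fun_prop
  let G : ProbabilityMeasure (Rd d) := ⟨stdGaussian (Rd d), inferInstance⟩
  refine ⟨fun μ => (μ.prod G).map hF.measurable.aemeasurable,
    (ProbabilityMeasure.continuous_map hF).comp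
      (ProbabilityMeasure.continuous_prod.comp (continuous_id.prodMk continuous_const)),
    fun μ => rfl⟩

/-- A weak limit of averages of the laws of the chain is invariant. -/
lemma isEulerInvariant_of_tendsto {d : ℕ} {U : Rd d → ℝ} {σ γ : ℝ} (hU : Continuous (∇ U))
    {x : Rd d} {μ : ℕ → ProbabilityMeasure (Rd d)}
    (hμ : ∀ n, (μ n : Measure (Rd d)) = cesaroLaw U σ γ x n) {s : ℕ → ℕ} (hs : StrictMono s)
    {π : ProbabilityMeasure (Rd d)}
    (hlim : Filter.Tendsto (μ ∘ s) Filter.atTop (nhds π)) :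
    IsEulerInvariant U σ γ (π : Measure (Rd d)) := by
  have hUm := hU.measurable
  obtain ⟨T, hT, hTμ⟩ := continuous_eulerLaw (σ := σ) (γ := γ) hU
  have h1 : Filter.Tendsto (T ∘ μ ∘ s) Filter.atTop (nhds (T π)) := (hT.tendsto π).comp hlim
  have h2 : Filter.Tendsto (T ∘ μ ∘ s) Filter.atTop (nhds π) := by
    rw [ProbabilityMeasure.tendsto_iff_forall_integral_tendsto] at hlim ⊢
    intro g
    have hdiff : ∀ n, ∫ y, g y ∂(T (μ n) : Measure (Rd d)) = ∫ y, g y ∂(μ n : Measure (Rd d))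
        + ((n : ℝ) + 1)⁻¹ *
          (∫ y, g y ∂chainLaw U σ γ x (n + 1) - ∫ y, g y ∂chainLaw U σ γ x 0) := by
      intro n
      have p0 := isProbabilityMeasure_chainLaw (σ := σ) (γ := γ) hUm x 0
      have p1 := isProbabilityMeasure_chainLaw (σ := σ) (γ := γ) hUm x (n + 1)
      have p2 := isProbabilityMeasure_cesaroLaw (σ := σ) (γ := γ) hUm x n
      have p3 := isProbabilityMeasure_eulerLaw (σ := σ) (γ := γ) hUm (cesaroLaw U σ γ x n)
      have hi : ((n + 1 : ℕ) : ENNReal)⁻¹ ≠ ⊤ := by simp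
      have h3 := congrArg (fun ν => ∫ y, g y ∂ν)
        (eulerLaw_cesaroLaw_add (σ := σ) (γ := γ) hUm x n)
      rw [integral_add_measure (g.integrable _) ((g.integrable _).smul_measure hi),
        integral_add_measure (g.integrable _) ((g.integrable _).smul_measure hi),
        integral_smul_measure, integral_smul_measure] at h3
      simp only [ENNReal.toReal_inv, ENNReal.toReal_natCast, smul_eq_mul] at h3
      push_cast at h3
      rw [hTμ, hμ]
      linarith
    have hzero : Filter.Tendsto (fun n : ℕ => ((n : ℝ) + 1)⁻¹ *
        (∫ y, g y ∂chainLaw U σ γ x (n + 1) - ∫ y, g y ∂chainLaw U σ γ x 0))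
        Filter.atTop (nhds 0) := by
      have hbd : ∀ k, ‖∫ y, g y ∂chainLaw U σ γ x k‖ ≤ ‖g‖ := fun k => by
        have p0 := isProbabilityMeasure_chainLaw (σ := σ) (γ := γ) hUm x k
        exact g.norm_integral_le_norm _
      have hinv : Filter.Tendsto (fun n : ℕ => ((n : ℝ) + 1)⁻¹) Filter.atTop (nhds 0) := by
        simpa using tendsto_one_div_add_atTop_nhds_zero_nat (𝕜 := ℝ)
      refine hinv.zero_mul_isBoundedUnder_le (Filter.isBoundedUnder_of ⟨‖g‖ + ‖g‖, fun n => ?_⟩)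
      exact (norm_sub_le _ _).trans (add_le_add (hbd _) (hbd _))
    have h4 := (hlim g).add (hzero.comp hs.tendsto_atTop)
    rw [add_zero] at h4
    refine h4.congr fun n => ?_
    exact (hdiff (s n)).symm
  have h3 : T π = π := tendsto_nhds_unique h1 h2
  refine ⟨inferInstance, ?_⟩
  have h4 := hTμ π
  rw [h3] at h4
  exact h4.symm

/-- There is an invariant law with moments of all orders, uniformly bounded in the data once the
distance to the minimizer is scaled. -/
lemma exists_isEulerInvariant {a : ℝ} (ha : 0 < a) (ha1 : a ≤ 1) :
    ∃ C : ℕ → ℝ, (∀ q, 0 < C q) ∧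
      ∀ (d : ℕ) (r L c σ γ Ψ : ℝ) (U : Rd d → ℝ) (xs : Rd d), 1 ≤ d →
      HypH1 r L c U → U xs = 1 → 0 ≤ r → r < 1 → 0 < γ → γ * L ≤ 1 →
      a * (d * (1 + σ ^ 2)) ≤ Ψ →
      ∃ π : Measure (Rd d), IsEulerInvariant U σ γ π ∧
        ∀ q : ℕ, ∫⁻ y, ENNReal.ofReal (scaledSqDist r c Ψ xs y ^ q) ∂π ≤ ENNReal.ofReal (C q) := by
  choose C hC hsum using fun q => exists_sum_lintegral_scaledSqDist_le q ha ha1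
  refine ⟨C, hC, fun d r L c σ γ Ψ U xs hd h hxs hr hr1 hγ hγL hΨ => ?_⟩
  have hΨ0 : 0 < Ψ := ha.trans_le (scale_le_of_mul_le hd ha hΨ)
  have hc := h.c_pos
  have hD : 0 < Ψ ^ (1 + r) := Real.rpow_pos_of_pos hΨ0 _
  have hUm := h.measurable_gradient
  set v := scaledSqDist r c Ψ xs with hv
  have hvc : Continuous v := continuous_scaledSqDist r c Ψ xs
  have hv0 : ∀ y, 0 ≤ v y := scaledSqDist_nonneg hc.le hΨ0.le xs
  have hmom : ∀ q n, ∫⁻ y, ENNReal.ofReal (v y ^ q) ∂cesaroLaw U σ γ xs n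
      ≤ ENNReal.ofReal (C q) := by
    intro q n
    rw [lintegral_cesaroLaw]
    have h1 := hsum q d r L c σ γ Ψ U xs hd h hxs hr hr1 hγ hγL hΨ (n + 1)
    have h2 : ∀ k, ∫⁻ y, ENNReal.ofReal (v y ^ q) ∂chainLaw U σ γ xs k
        = ∫⁻ z, ENNReal.ofReal (v (chain U σ γ k xs z) ^ q) ∂noiseLaw d := fun k =>
      lintegral_chainLaw hUm xs k (g := fun y => ENNReal.ofReal (v y ^ q))
        (hvc.measurable.pow_const q).ennreal_ofReal
    simp only [h2]
    refine (mul_le_mul_right h1 _).trans ?_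
    rw [← mul_assoc, ENNReal.inv_mul_cancel (by simp) (ENNReal.natCast_ne_top _), one_mul]
  let μ : ℕ → ProbabilityMeasure (Rd d) := fun n =>
    ⟨cesaroLaw U σ γ xs n, isProbabilityMeasure_cesaroLaw hUm xs n⟩
  -- Tightness, from the first moment.
  have htight : IsTightMeasureSet {((ν : ProbabilityMeasure (Rd d)) : Measure (Rd d)) |
      ν ∈ Set.range μ} := by
    rw [isTightMeasureSet_iff_exists_isCompact_measure_compl_le]
    intro ε hε
    rcases eq_or_ne ε ⊤ with rfl | hε'
    · exact ⟨∅, isCompact_empty, fun _ _ => le_top⟩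
    have hεr : 0 < ε.toReal := ENNReal.toReal_pos hε.ne' hε'
    set t := C 1 / ε.toReal with ht
    have ht0 : 0 < t := div_pos (hC 1) hεr
    refine ⟨{y | v y ≤ t}, ?_, ?_⟩
    · refine Metric.isCompact_of_isClosed_isBounded (isClosed_le hvc continuous_const) ?_
      refine (Metric.isBounded_closedBall (x := xs) (r := t * Ψ ^ (1 + r) / c + 1)).subset ?_
      intro y hy
      rw [mem_closedBall_iff_norm]
      have h1 : ‖y - xs‖ ^ 2 ≤ t * Ψ ^ (1 + r) / c := by
        have h2 : c * ‖y - xs‖ ^ 2 / Ψ ^ (1 + r) ≤ t := hy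
        rw [div_le_iff₀ hD] at h2
        rw [le_div_iff₀ hc]
        linarith
      nlinarith [sq_nonneg (‖y - xs‖ - 1)]
    · rintro _ ⟨_, ⟨n, rfl⟩, rfl⟩
      have h1 := hmom 1 n
      simp only [pow_one] at h1
      have h2 : {y | v y ≤ t}ᶜ ⊆ {y | ENNReal.ofReal t ≤ ENNReal.ofReal (v y)} := by
        intro y hy
        have h3 : ¬ v y ≤ t := hy
        exact ENNReal.ofReal_le_ofReal (not_le.1 h3).le
      calc cesaroLaw U σ γ xs n {y | v y ≤ t}ᶜ
          ≤ cesaroLaw U σ γ xs n {y | ENNReal.ofReal t ≤ ENNReal.ofReal (v y)} :=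
            measure_mono h2
        _ ≤ (∫⁻ y, ENNReal.ofReal (v y) ∂cesaroLaw U σ γ xs n) / ENNReal.ofReal t :=
            meas_ge_le_lintegral_div hvc.measurable.ennreal_ofReal.aemeasurable
              (ENNReal.ofReal_pos.2 ht0).ne' ENNReal.ofReal_ne_top
        _ ≤ ENNReal.ofReal (C 1) / ENNReal.ofReal t := by gcongr
        _ = ε := by
            rw [← ENNReal.ofReal_div_of_pos ht0, ht, div_div_cancel₀ (hC 1).ne',
              ENNReal.ofReal_toReal hε']
  obtain ⟨π, -, s, hs, hlim⟩ := (isCompact_closure_of_isTightMeasureSet htight).isSeqCompact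
    (fun n => subset_closure (Set.mem_range_self n) : ∀ n, μ n ∈ closure (Set.range μ))
  refine ⟨π, isEulerInvariant_of_tendsto h.contDiff_gradient.continuous (fun _ => rfl) hs hlim,
    fun q => ?_⟩
  refine (lintegral_le_liminf_lintegral_of_forall_isOpen_measure_le_liminf_measure
    (hvc.pow q) (fun y => pow_nonneg (hv0 y) q)
    (fun G hG => ProbabilityMeasure.le_liminf_measure_open_of_tendsto hlim hG)).trans ?_
  refine (Filter.liminf_le_liminf (Filter.Eventually.of_forall fun n => hmom q (s n))).trans ?_
  simp

/-! ### Uniqueness of the invariant law -/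

lemma norm_exp_inner_mul_I_sub_le {d : ℕ} (t x y : Rd d) :
    ‖Complex.exp ((inner ℝ x t : ℝ) * Complex.I) - Complex.exp ((inner ℝ y t : ℝ) * Complex.I)‖
      ≤ ‖t‖ * ‖x - y‖ := by
  have h1 : Complex.exp ((inner ℝ x t : ℝ) * Complex.I)
      - Complex.exp ((inner ℝ y t : ℝ) * Complex.I)
      = Complex.exp ((inner ℝ y t : ℝ) * Complex.I) *
        (Complex.exp (Complex.I * (inner ℝ (x - y) t : ℝ)) - 1) := by
    rw [mul_sub, ← Complex.exp_add, mul_one, inner_sub_left]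
    push_cast
    ring_nf
  rw [h1, norm_mul, Complex.norm_exp_ofReal_mul_I, one_mul]
  refine Real.norm_exp_I_mul_ofReal_sub_one_le.trans ?_
  rw [mul_comm]
  exact abs_real_inner_le_norm _ _

section Coupling

variable {d : ℕ} {U : Rd d → ℝ} {σ γ : ℝ} {μ ν : Measure (Rd d)}

lemma IsEulerInvariant.map_chain_fst (hU : Measurable (∇ U)) (hμ : IsEulerInvariant U σ γ μ)
    [IsProbabilityMeasure ν] (n : ℕ) :
    ((μ.prod ν).prod (noiseLaw d)).map (fun p => chain U σ γ n p.1.1 p.2) = μ := by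
  have := hμ.isProbabilityMeasure
  have h1 := Measure.map_prod_map (μ.prod ν) (noiseLaw d) measurable_fst measurable_id
  rw [Measure.map_fst_prod, measure_univ, one_smul, Measure.map_id] at h1
  have h2 := hμ.map_chain hU n
  rw [h1, Measure.map_map (measurable_chain_uncurry hU n)
    (measurable_fst.prodMap measurable_id)] at h2
  exact h2

lemma IsEulerInvariant.map_chain_snd (hU : Measurable (∇ U)) (hν : IsEulerInvariant U σ γ ν)
    [IsProbabilityMeasure μ] (n : ℕ) :
    ((μ.prod ν).prod (noiseLaw d)).map (fun p => chain U σ γ n p.1.2 p.2) = ν := by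
  have := hν.isProbabilityMeasure
  have h1 := Measure.map_prod_map (μ.prod ν) (noiseLaw d) measurable_snd measurable_id
  rw [Measure.map_snd_prod, measure_univ, one_smul, Measure.map_id] at h1
  have h2 := hν.map_chain hU n
  rw [h1, Measure.map_map (measurable_chain_uncurry hU n)
    (measurable_snd.prodMap measurable_id)] at h2
  exact h2

end Coupling

/-- The distance between two synchronously coupled chains tends to `0` in `L^1`. -/
lemma tendsto_lintegral_norm_chain_sub {d : ℕ} {r L c σ γ : ℝ} {U : Rd d → ℝ} (hd : 1 ≤ d)
    (h : HypH1 r L c U) (hr : 0 ≤ r) (hr1 : r < 1) (hγ : 0 < γ) (hγL : γ * L ≤ 1) (x y : Rd d) :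
    Filter.Tendsto (fun n => ∫⁻ z, ENNReal.ofReal ‖chain U σ γ n x z - chain U σ γ n y z‖
      ∂noiseLaw d) Filter.atTop (nhds 0) := by
  obtain ⟨xs, hxs, -⟩ := h.exists_unique_min
  obtain ⟨K, -, hdecay⟩ := exists_lintegral_norm_chain_sub_le 1 one_pos le_rfl
  set Ψ : ℝ := d * (1 + σ ^ 2) with hΨ
  have hΨ0 : 0 < Ψ := by positivity
  have hc := h.c_pos
  have hΨr : 0 < Ψ ^ r := Real.rpow_pos_of_pos hΨ0 r
  have hT : Filter.Tendsto (fun n : ℕ => c * (n * γ) / Ψ ^ r) Filter.atTop Filter.atTop :=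
    ((tendsto_natCast_atTop_atTop.atTop_mul_const hγ).const_mul_atTop hc).atTop_div_const hΨr
  set B := ‖x - y‖ * (1 + scaledSqDist r c Ψ xs x + scaledSqDist r c Ψ xs y) with hB
  have hlim : Filter.Tendsto (fun n : ℕ => ENNReal.ofReal (K / (c * (n * γ) / Ψ ^ r) * B))
      Filter.atTop (nhds 0) := by
    have h1 := ((hT.const_div_atTop K).mul_const B)
    rw [zero_mul] at h1
    simpa using ENNReal.tendsto_ofReal h1
  refine tendsto_of_tendsto_of_tendsto_of_le_of_le' tendsto_const_nhds hlim
    (Filter.Eventually.of_forall fun _ => zero_le) ?_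
  filter_upwards [hT.eventually_ge_atTop 1, Filter.eventually_gt_atTop 0] with n hn hn0
  refine (hdecay d r L c σ γ Ψ U xs x y hd h hxs hr hr1 hγ hγL (by rw [one_mul]) n hn0 hn).trans
    (le_of_eq ?_)
  rw [pow_one, pow_one, mul_assoc]

/-- Any two invariant laws agree, since a synchronous coupling of the two stationary chains shows
that they have the same characteristic function. -/
lemma IsEulerInvariant.unique {d : ℕ} {r L c σ γ : ℝ} {U : Rd d → ℝ} (hd : 1 ≤ d)
    (h : HypH1 r L c U) (hr : 0 ≤ r) (hr1 : r < 1) (hγ : 0 < γ) (hγL : γ * L ≤ 1)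
    {μ ν : Measure (Rd d)} (hμ : IsEulerInvariant U σ γ μ) (hν : IsEulerInvariant U σ γ ν) :
    μ = ν := by
  have i1 := hμ.isProbabilityMeasure
  have i2 := hν.isProbabilityMeasure
  have hUm := h.measurable_gradient
  refine Measure.ext_of_charFun (funext fun t => ?_)
  rw [charFun_apply, charFun_apply]
  set g : Rd d → ℂ := fun x => Complex.exp ((inner ℝ x t : ℝ) * Complex.I) with hg
  have hgc : Continuous g := by fun_prop
  have hg1 : ∀ x, ‖g x‖ = 1 := fun x => Complex.norm_exp_ofReal_mul_I _
  have hX : ∀ n, Measurable fun p : (Rd d × Rd d) × (ℕ → Rd d) => chain U σ γ n p.1.1 p.2 :=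
    fun n => (measurable_chain_uncurry hUm n).comp
      ((measurable_fst.comp measurable_fst).prodMk measurable_snd)
  have hY : ∀ n, Measurable fun p : (Rd d × Rd d) × (ℕ → Rd d) => chain U σ γ n p.1.2 p.2 :=
    fun n => (measurable_chain_uncurry hUm n).comp
      ((measurable_snd.comp measurable_fst).prodMk measurable_snd)
  let F : ℕ → Rd d × Rd d → ENNReal := fun n w =>
    ∫⁻ z, ‖g (chain U σ γ n w.1 z) - g (chain U σ γ n w.2 z)‖ₑ ∂noiseLaw d
  have hm : ∀ n, Measurable fun p : (Rd d × Rd d) × (ℕ → Rd d) =>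
      ‖g (chain U σ γ n p.1.1 p.2) - g (chain U σ γ n p.1.2 p.2)‖ₑ := fun n =>
    ((hgc.measurable.comp (hX n)).sub (hgc.measurable.comp (hY n))).enorm
  have hle : ∀ n, ‖∫ x, g x ∂μ - ∫ x, g x ∂ν‖ₑ ≤ ∫⁻ w, F n w ∂μ.prod ν := by
    intro n
    have e1 : ∫ x, g x ∂μ = ∫ p, g (chain U σ γ n p.1.1 p.2) ∂(μ.prod ν).prod (noiseLaw d) := by
      conv_lhs => rw [← hμ.map_chain_fst (ν := ν) hUm n]
      exact integral_map (hX n).aemeasurable hgc.aestronglyMeasurable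
    have e2 : ∫ x, g x ∂ν = ∫ p, g (chain U σ γ n p.1.2 p.2) ∂(μ.prod ν).prod (noiseLaw d) := by
      conv_lhs => rw [← hν.map_chain_snd (μ := μ) hUm n]
      exact integral_map (hY n).aemeasurable hgc.aestronglyMeasurable
    have j1 : Integrable (fun p => g (chain U σ γ n p.1.1 p.2)) ((μ.prod ν).prod (noiseLaw d)) :=
      Integrable.of_bound (hgc.measurable.comp (hX n)).aestronglyMeasurable 1
        (Filter.Eventually.of_forall fun p => (hg1 _).le)
    have j2 : Integrable (fun p => g (chain U σ γ n p.1.2 p.2)) ((μ.prod ν).prod (noiseLaw d)) :=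
      Integrable.of_bound (hgc.measurable.comp (hY n)).aestronglyMeasurable 1
        (Filter.Eventually.of_forall fun p => (hg1 _).le)
    rw [e1, e2, ← integral_sub j1 j2]
    refine (enorm_integral_le_lintegral_enorm _).trans (le_of_eq ?_)
    exact lintegral_prod _ (hm n).aemeasurable
  have hlim : Filter.Tendsto (fun n => ∫⁻ w, F n w ∂μ.prod ν) Filter.atTop (nhds 0) := by
    have h0 : ∫⁻ _, (0 : ENNReal) ∂μ.prod ν = 0 := lintegral_zero
    rw [← h0]
    refine tendsto_lintegral_of_dominated_convergence (fun _ => 2)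
      (fun n => (hm n).lintegral_prod_right') (fun n => Filter.Eventually.of_forall fun w => ?_)
      (by simp) (Filter.Eventually.of_forall fun w => ?_)
    · calc F n w ≤ ∫⁻ _, 2 ∂noiseLaw d := by
            refine lintegral_mono fun z => ?_
            rw [← ofReal_norm, ← ENNReal.ofReal_ofNat 2]
            refine ENNReal.ofReal_le_ofReal ((norm_sub_le _ _).trans (le_of_eq ?_))
            rw [hg1, hg1]; norm_num
        _ = 2 := by simp
    · have h1 := tendsto_lintegral_norm_chain_sub (σ := σ) hd h hr hr1 hγ hγL w.1 w.2
      have h2 := ENNReal.Tendsto.const_mul (a := ENNReal.ofReal ‖t‖) h1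
        (Or.inr ENNReal.ofReal_ne_top)
      rw [mul_zero] at h2
      refine tendsto_of_tendsto_of_tendsto_of_le_of_le tendsto_const_nhds h2
        (fun _ => zero_le) fun n => ?_
      simp only [F]
      rw [← lintegral_const_mul' _ _ ENNReal.ofReal_ne_top]
      refine lintegral_mono fun z => ?_
      rw [← ENNReal.ofReal_mul (norm_nonneg t), ← ofReal_norm]
      exact ENNReal.ofReal_le_ofReal (norm_exp_inner_mul_I_sub_le t _ _)
  have h0 : ‖∫ x, g x ∂μ - ∫ x, g x ∂ν‖ₑ = 0 := le_antisymm (ge_of_tendsto' hlim hle) zero_le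
  exact sub_eq_zero.1 (enorm_eq_zero.1 h0)

/-! ### Convergence to the invariant law -/

/-- The infimum that defines the Lipschitz constant is itself a Lipschitz constant. -/
lemma norm_sub_le_lipConst_mul {d : ℕ} {f : Rd d → ℝ} (hf : ∃ M : ℝ≥0, LipschitzWith M f)
    (x y : Rd d) :
    ‖f x - f y‖ ≤ lipConst f * ‖x - y‖ := by
  rcases eq_or_ne x y with rfl | hxy
  · simp
  have hxy' : 0 < ‖x - y‖ := norm_pos_iff.2 (sub_ne_zero.2 hxy)
  rw [← div_le_iff₀ hxy', lipConst]
  have h1 : (‖f x - f y‖₊ / ‖x - y‖₊ : ℝ≥0) ≤ sInf {K : ℝ≥0 | LipschitzWith K f} := by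
    refine le_csInf hf fun K hK => ?_
    rw [← NNReal.coe_le_coe]
    push_cast
    rw [div_le_iff₀ hxy']
    have := LipschitzWith.dist_le_mul hK x y
    rwa [dist_eq_norm, dist_eq_norm] at this
  have h2 := NNReal.coe_le_coe.2 h1
  rwa [NNReal.coe_div, coe_nnnorm, coe_nnnorm] at h2

lemma integrable_comp_of_lipschitzWith {d : ℕ} {Ω : Type*} [MeasurableSpace Ω] {P : Measure Ω}
    [IsProbabilityMeasure P] {X : Ω → Rd d} (hX : Measurable X) (xs : Rd d)
    (hfin : ∫⁻ ω, ENNReal.ofReal (‖X ω - xs‖ ^ 2) ∂P ≠ ⊤) {f : Rd d → ℝ}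
    (hf : ∃ M : ℝ≥0, LipschitzWith M f) : Integrable (fun ω => f (X ω)) P := by
  obtain ⟨M, hM⟩ := hf
  have h1 : Integrable (fun ω => ‖X ω - xs‖ ^ 2) P :=
    (lintegral_ofReal_ne_top_iff_integrable
      ((hX.sub_const xs).norm.pow_const 2).aestronglyMeasurable
      (Filter.Eventually.of_forall fun _ => sq_nonneg _)).1 hfin
  refine Integrable.mono' ((integrable_const (|f xs| + M)).add (h1.const_mul (M : ℝ)))
    (hM.continuous.measurable.comp hX).aestronglyMeasurable
    (Filter.Eventually.of_forall fun ω => ?_)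
  have h2 := hM.dist_le_mul (X ω) xs
  rw [dist_eq_norm, dist_eq_norm, Real.norm_eq_abs] at h2
  have h3 : |f (X ω)| ≤ |f xs| + |f (X ω) - f xs| := by
    have := abs_add_le (f xs) (f (X ω) - f xs)
    rwa [add_sub_cancel] at this
  have h4 : ‖X ω - xs‖ ≤ 1 + ‖X ω - xs‖ ^ 2 := by nlinarith [sq_nonneg (‖X ω - xs‖ - 1)]
  have h5 := mul_le_mul_of_nonneg_left h4 M.coe_nonneg
  rw [Real.norm_eq_abs]
  simp only [Pi.add_apply]
  linarith

lemma IsGaussianNoise.map_eq_noiseLaw {d : ℕ} {Ω : Type*} [MeasurableSpace Ω] {P : Measure Ω}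
    {Z : ℕ → Ω → Rd d} (hZ : IsGaussianNoise P Z) :
    AEMeasurable (fun ω k => Z k ω) P ∧ P.map (fun ω k => Z k ω) = noiseLaw d := by
  have hm : AEMeasurable (fun ω k => Z k ω) P := aemeasurable_pi_iff.2 fun k =>
    (hZ.hasLaw k).aemeasurable
  exact ⟨hm, (iIndepFun.hasLaw_infinitePi hZ.hasLaw hZ.indep hm).map_eq⟩

lemma rate_nonneg {r κ γ c Ψ : ℝ} (hγ : 0 < γ) (hc : 0 < c) (hΨ : 0 < Ψ) {φ : ℝ≥0 → ℝ}
    (hφ : ∀ t, 0 < φ t) (n : ℕ) : 0 ≤ rate r κ γ c Ψ φ n := by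
  have := hφ n
  unfold rate
  positivity

/-- Both choices of parameters satisfy the only two bounds that the argument uses. -/
lemma IsParameterPair.bounds {d : ℕ} {r cr σ L c γstar Ψ : ℝ} {U : Rd d → ℝ} (hd : 1 ≤ d)
    (h : HypH1 r L c U) (hr0 : 0 ≤ r) (hcr : 0 < cr)
    (hp : IsParameterPair r cr σ L c U γstar Ψ) :
    γstar * L ≤ 1 ∧ min 1 cr * (d * (1 + σ ^ 2)) ≤ Ψ := by
  have hL := h.L_pos
  have hL1 := h.one_le_L
  have hc := h.c_pos
  have hdσ : 0 ≤ d * (1 + σ ^ 2) := by positivity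
  rcases hp with ⟨rfl, rfl⟩ | ⟨cbar, -, rfl, rfl⟩
  · constructor
    · rw [div_mul_eq_mul_div, one_mul, div_le_one (by positivity)]; linarith
    · have h1 : (0 : ℝ) ≤ (1 + d * L / c) ^ (1 / (1 - r)) := by positivity
      have h2 : (d : ℝ) ≤ d * L := le_mul_of_one_le_right (by positivity) hL1
      calc min 1 cr * (d * (1 + σ ^ 2)) ≤ 1 * (d * (1 + σ ^ 2)) := by
            gcongr; exact min_le_left _ _
        _ = (1 + σ ^ 2) * d := by ring
        _ ≤ _ := by gcongr; linarith
  · have hm : L ≤ max cbar L := le_max_right _ _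
    have hm0 : 0 < max cbar L := hL.trans_le hm
    constructor
    · rw [div_mul_eq_mul_div, div_le_one (by positivity)]
      nlinarith
    · have h1 : 1 ≤ max cbar L / c := (one_le_div hc).2 ((h.c_le_L hd).trans hm)
      calc min 1 cr * (d * (1 + σ ^ 2)) ≤ cr * (d * (1 + σ ^ 2)) := by
            gcongr; exact min_le_right _ _
        _ ≤ cr * (d * (1 + σ ^ 2)) * (max cbar L / c) :=
            le_mul_of_one_le_right (by positivity) h1
        _ = _ := by ring

/-- The bound on the error on the space of noise sequences. The starting point `y` of the second
chain is integrated against the invariant law. -/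
lemma exists_abs_integral_sub_le_rate {r κ : ℝ} (hκ : 0 < κ) (hr : 0 ≤ r) (hr1 : r < 1) {a : ℝ}
    (ha : 0 < a) (ha1 : a ≤ 1) {C : ℝ} (hC : 0 < C) (Cm : ℕ → ℝ) (hCm : ∀ q, 0 < Cm q) :
    ∃ K : ℝ, 0 < K ∧ ∀ (d : ℕ) (L c σ γ Ψ : ℝ) (U : Rd d → ℝ) (xs : Rd d)
      (π : Measure (Rd d)), 1 ≤ d → HypH1 r L c U → U xs = 1 → 0 < γ → γ * L ≤ 1 →
      a * (d * (1 + σ ^ 2)) ≤ Ψ → IsEulerInvariant U σ γ π →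
      (∀ q : ℕ, ∫⁻ y, ENNReal.ofReal (scaledSqDist r c Ψ xs y ^ q) ∂π ≤ ENNReal.ofReal (Cm q)) →
      ∀ x : Rd d, U x ≤ C * Ψ → ∀ φ : ℝ≥0 → ℝ, (∀ t, 0 < φ t) → ∀ n : ℕ, 0 < n →
      ∀ f : Rd d → ℝ, (∃ M : ℝ≥0, LipschitzWith M f) →
        Integrable f π ∧ Integrable (fun z => f (chain U σ γ n x z)) (noiseLaw d) ∧
        |(∫ z, f (chain U σ γ n x z) ∂noiseLaw d) - ∫ y, f y ∂π|
          ≤ K * lipConst f * rate r κ γ c Ψ φ n := by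
  obtain ⟨K, hK, hdecay⟩ := exists_lintegral_norm_chain_sub_le_rate hκ ha ha1
  obtain ⟨C₁, -, hmom⟩ := exists_lintegral_sq_add_excess_le 1
  set q := ⌈κ / 2⌉₊ + 1 with hq
  set A := 4 * C ^ (1 + r) with hA
  have hA0 : 0 < A := by positivity
  set Q := 2 ^ q * ((1 + A) ^ q + Cm q) with hQ
  have hQ0 : 0 < Q := by have := hCm q; positivity
  refine ⟨K * Q, by positivity, ?_⟩
  intro d L c σ γ Ψ U xs π hd h hxs hγ hγL hΨ hπ hπm x hx φ hφ n hn f hf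
  have hΨ0 : 0 < Ψ := ha.trans_le (scale_le_of_mul_le hd ha hΨ)
  have hc := h.c_pos
  have hD : 0 < Ψ ^ (1 + r) := Real.rpow_pos_of_pos hΨ0 _
  have iπ := hπ.isProbabilityMeasure
  have hUm := h.measurable_gradient
  have hcm := measurable_chain (σ := σ) (γ := γ) hUm n x
  have hcu := measurable_chain_uncurry (σ := σ) (γ := γ) hUm n
  have hv0 : ∀ y, 0 ≤ scaledSqDist r c Ψ xs y := scaledSqDist_nonneg hc.le hΨ0.le xs
  have hvm := measurable_scaledSqDist r c Ψ xs
  have hrate := rate_nonneg (r := r) (κ := κ) hγ hc hΨ0 hφ n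
  have hlip0 : 0 ≤ lipConst f := NNReal.coe_nonneg _
  have hfc : Continuous f := let ⟨_, hM⟩ := hf; hM.continuous
  have int1 : Integrable f π := by
    refine integrable_comp_of_lipschitzWith measurable_id xs (ne_of_lt ?_) hf
    have e : ∀ y : Rd d, ENNReal.ofReal (‖id y - xs‖ ^ 2) = ENNReal.ofReal (Ψ ^ (1 + r) / c) *
        ENNReal.ofReal (scaledSqDist r c Ψ xs y ^ 1) := by
      intro y
      rw [← ENNReal.ofReal_mul (by positivity), scaledSqDist, id, pow_one]
      congr 1; field_simp
    simp only [e]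
    rw [lintegral_const_mul' _ _ ENNReal.ofReal_ne_top]
    exact ENNReal.mul_lt_top ENNReal.ofReal_lt_top ((hπm 1).trans_lt ENNReal.ofReal_lt_top)
  have int2 : Integrable (fun z => f (chain U σ γ n x z)) (noiseLaw d) := by
    refine integrable_comp_of_lipschitzWith hcm xs (ne_of_lt ?_) hf
    refine lt_of_le_of_lt (lintegral_mono fun z => ENNReal.ofReal_le_ofReal ?_)
      ((hmom d r L c σ γ U xs x h hxs hγ.le hγL n).trans_lt ENNReal.ofReal_lt_top)
    rw [pow_one]
    linarith [excess_nonneg (σ := σ) h hγ.le n x z]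
  refine ⟨int1, int2, ?_⟩
  -- Both integrals as integrals over the coupling.
  have e1 : ∫ z, f (chain U σ γ n x z) ∂noiseLaw d
      = ∫ p, f (chain U σ γ n x p.2) ∂π.prod (noiseLaw d) := by
    rw [integral_fun_snd (fun z => f (chain U σ γ n x z))]; simp
  have e2 : ∫ y, f y ∂π = ∫ p, f (chain U σ γ n p.1 p.2) ∂π.prod (noiseLaw d) := by
    conv_lhs => rw [← hπ.map_chain hUm n]
    exact integral_map hcu.aemeasurable hfc.aestronglyMeasurable
  have j1 : Integrable (fun p : Rd d × (ℕ → Rd d) => f (chain U σ γ n x p.2))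
      (π.prod (noiseLaw d)) := int2.comp_snd π
  have j2 : Integrable (fun p : Rd d × (ℕ → Rd d) => f (chain U σ γ n p.1 p.2))
      (π.prod (noiseLaw d)) := by
    have h1 : Integrable f ((π.prod (noiseLaw d)).map fun p => chain U σ γ n p.1 p.2) := by
      rw [hπ.map_chain hUm n]; exact int1
    exact h1.comp_measurable hcu
  have hvx : scaledSqDist r c Ψ xs x ≤ A := by
    rw [scaledSqDist, div_le_iff₀ hD, hA, mul_assoc, ← Real.mul_rpow hC.le hΨ0.le]
    have hU0 := h.pos x
    refine (h.mul_norm_sq_le hr hxs x).trans ?_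
    gcongr
  have hpow : ∀ y, (1 + scaledSqDist r c Ψ xs x + scaledSqDist r c Ψ xs y) ^ q
      ≤ 2 ^ q * ((1 + A) ^ q + scaledSqDist r c Ψ xs y ^ q) := by
    intro y
    have h1 := hv0 y
    have h2 := hv0 x
    calc (1 + scaledSqDist r c Ψ xs x + scaledSqDist r c Ψ xs y) ^ q
        ≤ ((1 + A) + scaledSqDist r c Ψ xs y) ^ q := by gcongr
      _ ≤ (2 * max (1 + A) (scaledSqDist r c Ψ xs y)) ^ q := by
          gcongr
          linarith [le_max_left (1 + A) (scaledSqDist r c Ψ xs y),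
            le_max_right (1 + A) (scaledSqDist r c Ψ xs y)]
      _ ≤ _ := by
          rw [mul_pow]
          gcongr
          rcases max_choice (1 + A) (scaledSqDist r c Ψ xs y) with h3 | h3 <;> rw [h3]
          · linarith [pow_nonneg h1 q]
          · linarith [pow_nonneg (by positivity : 0 ≤ 1 + A) q]
  have hmain : ∫⁻ p, ENNReal.ofReal ‖f (chain U σ γ n x p.2) - f (chain U σ γ n p.1 p.2)‖
      ∂π.prod (noiseLaw d) ≤ ENNReal.ofReal (K * Q * lipConst f * rate r κ γ c Ψ φ n) := by
    have hΔm : Measurable fun p : Rd d × (ℕ → Rd d) =>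
        ENNReal.ofReal ‖chain U σ γ n x p.2 - chain U σ γ n p.1 p.2‖ :=
      ((hcm.comp measurable_snd).sub hcu).norm.ennreal_ofReal
    calc _ ≤ ∫⁻ p, ENNReal.ofReal (lipConst f) *
          ENNReal.ofReal ‖chain U σ γ n x p.2 - chain U σ γ n p.1 p.2‖ ∂π.prod (noiseLaw d) := by
          refine lintegral_mono fun p => ?_
          rw [← ENNReal.ofReal_mul hlip0]
          exact ENNReal.ofReal_le_ofReal (norm_sub_le_lipConst_mul hf _ _)
      _ = ENNReal.ofReal (lipConst f) * ∫⁻ y, ∫⁻ z,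
          ENNReal.ofReal ‖chain U σ γ n x z - chain U σ γ n y z‖ ∂noiseLaw d ∂π := by
          rw [lintegral_const_mul' _ _ ENNReal.ofReal_ne_top, lintegral_prod _ hΔm.aemeasurable]
      _ ≤ ENNReal.ofReal (lipConst f) * ∫⁻ y, ENNReal.ofReal (K * rate r κ γ c Ψ φ n * 2 ^ q) *
          (ENNReal.ofReal ((1 + A) ^ q) + ENNReal.ofReal (scaledSqDist r c Ψ xs y ^ q)) ∂π := by
          gcongr with y
          have h1 := hv0 y
          refine (hdecay d r L c σ γ Ψ U xs x y hd h hxs hr hr1 hγ hγL hΨ φ hφ n hn).trans ?_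
          rw [← ENNReal.ofReal_add (by positivity) (by positivity),
            ← ENNReal.ofReal_mul (by positivity), mul_assoc (K * _)]
          refine ENNReal.ofReal_le_ofReal ?_
          have h2 := hpow y
          gcongr
      _ = ENNReal.ofReal (lipConst f) * (ENNReal.ofReal (K * rate r κ γ c Ψ φ n * 2 ^ q) *
          (ENNReal.ofReal ((1 + A) ^ q)
            + ∫⁻ y, ENNReal.ofReal (scaledSqDist r c Ψ xs y ^ q) ∂π)) := by
          rw [lintegral_const_mul' _ _ ENNReal.ofReal_ne_top, lintegral_add_left measurable_const]
          simp
      _ ≤ ENNReal.ofReal (lipConst f) * (ENNReal.ofReal (K * rate r κ γ c Ψ φ n * 2 ^ q) *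
          (ENNReal.ofReal ((1 + A) ^ q) + ENNReal.ofReal (Cm q))) := by
          gcongr; exact hπm q
      _ = _ := by
          have h1 := hCm q
          rw [← ENNReal.ofReal_add (by positivity) (by positivity),
            ← ENNReal.ofReal_mul (by positivity), ← ENNReal.ofReal_mul hlip0]
          congr 1
          rw [hQ]; ring
  rw [e1, e2, ← integral_sub j1 j2, ← Real.norm_eq_abs]
  exact (norm_integral_le_lintegral_norm _).trans
    (ENNReal.toReal_le_of_le_ofReal (by positivity) hmain)

end

theorem mainTheorem4 (r : ℝ) (hr0 : 0 ≤ r) (hr1 : r < 1) (κ : ℝ) (hκ : 0 < κ)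
    (cr : ℝ) (hcr : 0 < cr) (C : ℝ) (hC : 0 < C) :
    ∃ K : ℝ, 0 < K ∧
      ∀ (d : ℕ), 1 ≤ d → ∀ (σ L c : ℝ) (U : Rd d → ℝ), 0 < σ → HypH1 r L c U →
      ∀ (γstar Ψ : ℝ), IsParameterPair r cr σ L c U γstar Ψ →
      ∀ (γ : ℝ), 0 < γ → γ ≤ γstar →
      ∃ πγ : Measure (Rd d), IsEulerInvariant U σ γ πγ ∧
        (∀ ν : Measure (Rd d), IsEulerInvariant U σ γ ν → ν = πγ) ∧
        ∀ (Ω : Type*) (_ : MeasurableSpace Ω) (P : Measure Ω) (_ : IsProbabilityMeasure P)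
          (Z : ℕ → Ω → Rd d), IsGaussianNoise P Z →
        ∀ (x : Rd d), U x ≤ C * Ψ →
        ∀ (φ : ℝ≥0 → ℝ), (∀ t, 0 < φ t) →
        ∀ (n : ℕ), 0 < n →
        ∀ (f : Rd d → ℝ), (∃ M : ℝ≥0, LipschitzWith M f) →
          Integrable f πγ ∧
          Integrable (fun ω => f (eulerScheme U σ γ Z x n ω)) P ∧
          |(∫ ω, f (eulerScheme U σ γ Z x n ω) ∂P) - ∫ y, f y ∂πγ|
            ≤ K * lipConst f * rate r κ γ c Ψ φ n := by
  have ha : 0 < min 1 cr := lt_min one_pos hcr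
  obtain ⟨Cm, hCm, hex⟩ := exists_isEulerInvariant ha (min_le_left 1 cr)
  obtain ⟨K, hK, hmain⟩ :=
    exists_abs_integral_sub_le_rate hκ hr0 hr1 ha (min_le_left 1 cr) hC Cm hCm
  refine ⟨K, hK, fun d hd σ L c U _ h γstar Ψ hp γ hγ hγs => ?_⟩
  obtain ⟨hγL', hΨ⟩ := hp.bounds hd h hr0 hcr
  have hγL : γ * L ≤ 1 := (mul_le_mul_of_nonneg_right hγs h.L_pos.le).trans hγL'
  obtain ⟨xs, hxs, -⟩ := h.exists_unique_min
  obtain ⟨π, hπ, hπm⟩ := hex d r L c σ γ Ψ U xs hd h hxs hr0 hr1 hγ hγL hΨ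
  refine ⟨π, hπ, fun ν hν => hν.unique hd h hr0 hr1 hγ hγL hπ, ?_⟩
  intro Ω _ P _ Z hZ x hx φ hφ n hn f hf
  obtain ⟨i1, i2, hbound⟩ :=
    hmain d L c σ γ Ψ U xs π hd h hxs hγ hγL hΨ hπ hπm x hx φ hφ n hn f hf
  -- The noise may only be almost everywhere measurable, so its law is transported.
  obtain ⟨hZm, hZlaw⟩ := hZ.map_eq_noiseLaw
  rw [← hZlaw] at i2 hbound
  simp only [eulerScheme_eq_chain]
  have hsm : AEStronglyMeasurable (fun z => f (chain U σ γ n x z)) (P.map fun ω k => Z k ω) :=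
    i2.aestronglyMeasurable
  rw [integral_map hZm hsm] at hbound
  exact ⟨i1, i2.comp_aemeasurable hZm, hbound⟩
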